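/- **Theorem 3.1.** Let $N\ge 2$, $\alpha,\beta\in[0,1)$ with $0<\alpha+\beta<1$, $q\in(0,1]$, and let $\theta>0$ and $x^*$ satisfy $0<\theta x^*\le 1$ and $\theta x^*\ge 1-\theta$. Put $f(x)=f_{LP}(x)=\dfrac{x}{\theta(x+x^*)}$ for $x\in[0,1]$. Let $(r_n)_{n\ge 0}$ be a deterministic sequence in $[0,1]$ with $\lim_n n\,r_n=1$; if $\beta=0$ and $\theta x^*<1$, assume also that $$\sum_{n\ge 0}\ \prod_{k=0}^{n}(1-r_k)=+\infty$$ (this holds, for example, for $r_n=1/(N_0+n+1)$ with $N_0>0$). On a probability space with probability $P$, let $Z_{0,h}$ ($1\le h\le N$) be $[0,1]$-valued and $I_{n,h}$ ($n\ge1$, $1\le h\le N$) be $\{0,1\}$-valued random variables, set $$Z_{n+1,h}=(1-r_n)Z_{n,h}+r_nI_{n+1,h},\qquad Z_n=\frac1N\sum_{i=1}^N Z_{n,i},$$ $$\mathcal F_n=\sigma(Z_{0,h}:1\le h\le N)\vee\sigma(I_{k,h}:1\le k\le n,\ 1\le h\le N),$$ and suppose that, for every $n\ge0$, the variables $I_{n+1,1},\dots,I_{n+1,N}$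 are conditionally independent given $\mathcal F_n$ and $$P(I_{n+1,h}=1\mid\mathcal F_n)=\alpha Z_n+\beta q+(1-\alpha-\beta)f(Z_{n,h})\quad\text{a.s., for every } h .$$ Write $\mathbf Z_n=(Z_{n,1},\dots,Z_{n,N})$, $\mathbf I_n=(I_{n,1},\dots,I_{n,N})$, $\overline{\mathbf I}_n=\frac1n\sum_{k=1}^n\mathbf I_k$, and denote by $\mathbf 0$ and $\mathbf 1$ the vectors with all components $0$ and all components $1$. Let $\widehat P=P(\,\cdot\mid\mathbf Z_0\ne\mathbf 0)$ if $\beta=0$ and $\theta x^*<1$ (the claim being void if $P(\mathbf Z_0\neq\mathbf 0)=0$ in this case), and $\widehat P=P$ otherwise. Let $$z_\infty=\begin{cases}\hat z & \text{if }\beta>0,\\[2pt] \dfrac{1-\theta x^*}{\theta} & \text{if }\beta=0,\end{cases}\qquad \hat z=\frac{-b+\sqrt{\Delta}}{2(1-\alpha)\theta},$$ where $b=(1-\alpha)\theta x^*-\beta\theta q-(1-\alpha-\beta)$ and $\Delta=b^2+4(1-\alpha)\beta\theta^2 q x^*$. If $\beta>0$, then $0<\hat z\le 1$, and $\hat z=1$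 if and only if both $q=1$ and $\theta x^*=1-\theta$. Moreover, under $\widehat P$ the system almost surely asymptotically synchronizes (that is, $\mathbf Z_n$ converges a.s. to $Z_\infty\mathbf 1$ for some $[0,1]$-valued random variable $Z_\infty$) and is predictable (that is, the a.s. limit of $\mathbf Z_n$ is a deterministic vector); indeed, $\widehat P$-almost surely, $$\mathbf Z_n\longrightarrow z_\infty\mathbf 1\qquad\text{and}\qquad \overline{\mathbf I}_n\longrightarrow z_\infty\mathbf 1 .$$ -/

import Mathlib

open MeasureTheory ProbabilityTheory Filter Topology

noncomputable section

namespace ReinforcedSystem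

variable {Ω : Type*}

/-- The linear-probability function `f(x) = x / (θ (x + x*))`. -/
def fLP (θ xs : ℝ) (x : ℝ) : ℝ := x / (θ * (x + xs))

/-- The past `𝓕 n = σ(Z_{0,h} : h) ∨ σ(I_{k,h} : 1 ≤ k ≤ n, h)`. -/
@[reducible] def past {N : ℕ} (Z I : ℕ → Ω → Fin N → ℝ) (n : ℕ) : MeasurableSpace Ω :=
  (⨆ h, MeasurableSpace.comap (fun ω => Z 0 ω h) inferInstance) ⊔
    ⨆ k ∈ Finset.Icc 1 n, ⨆ h, MeasurableSpace.comap (fun ω => I k ω h) inferInstance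

/-- Conditional independence of a finite family of real random variables given `m`
(no regularity of `Ω` is required, since it is stated through conditional expectations). -/
def CondIndepFamily {N : ℕ} [MeasurableSpace Ω] (P : Measure Ω) (m : MeasurableSpace Ω)
    (X : Fin N → Ω → ℝ) : Prop :=
  ∀ (s : Finset (Fin N)) (B : Fin N → Set ℝ), (∀ h ∈ s, MeasurableSet (B h)) →
    P[(⋂ h ∈ s, X h ⁻¹' B h).indicator (fun _ => (1 : ℝ)) | m] =ᵐ[P]
      fun ω => ∏ h ∈ s, (P[(X h ⁻¹' B h).indicator (fun _ => (1 : ℝ)) | m]) ω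

/-- The mean-field system of `N` interacting reinforced processes: `Z n ω h` is the inclination
`Z_{n,h}` for `n ≥ 0`, and `I n ω h` is the choice `I_{n,h}` for `n ≥ 1`
(the value `I 0` plays no role). -/
structure IsSystem {N : ℕ} [MeasurableSpace Ω] (P : Measure Ω) (α β q : ℝ) (f : ℝ → ℝ)
    (r : ℕ → ℝ) (Z I : ℕ → Ω → Fin N → ℝ) : Prop where
  measurable_init : ∀ h, Measurable fun ω => Z 0 ω h
  init_mem : ∀ ω h, Z 0 ω h ∈ Set.Icc (0 : ℝ) 1
  measurable_choice : ∀ n h, Measurable fun ω => I (n + 1) ω h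
  choice_mem : ∀ n ω h, I (n + 1) ω h = 0 ∨ I (n + 1) ω h = 1
  dynamics : ∀ n ω h, Z (n + 1) ω h = (1 - r n) * Z n ω h + r n * I (n + 1) ω h
  condProb : ∀ n h,
    P[{ω | I (n + 1) ω h = 1}.indicator (fun _ => (1 : ℝ)) | past Z I n] =ᵐ[P]
      fun ω => α * ((∑ i, Z n ω i) / N) + β * q + (1 - α - β) * f (Z n ω h)
  condIndep : ∀ n, CondIndepFamily P (past Z I n) fun h ω => I (n + 1) ω h

/-- The empirical means `(1/n) ∑_{k=1}^n I_k`. -/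
def empMean {N : ℕ} (I : ℕ → Ω → Fin N → ℝ) (n : ℕ) (ω : Ω) (h : Fin N) : ℝ :=
  (∑ k ∈ Finset.Icc 1 n, I k ω h) / n

/-- Almost sure asymptotic synchronization under `Q`: the vector `Z n` converges almost surely
to `Z_∞ 𝟏` for one `[0,1]`-valued random variable `Z_∞`. -/
def Synchronizes {N : ℕ} [MeasurableSpace Ω] (Q : Measure Ω) (Z : ℕ → Ω → Fin N → ℝ) : Prop :=
  ∃ Zinf : Ω → ℝ, Measurable Zinf ∧ (∀ ω, Zinf ω ∈ Set.Icc (0 : ℝ) 1) ∧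
    ∀ᵐ ω ∂Q, Tendsto (fun n => Z n ω) atTop (𝓝 fun _ => Zinf ω)

/-- Predictability under `Q`: the almost sure limit of `Z n` is a deterministic point. -/
def Predictable {N : ℕ} [MeasurableSpace Ω] (Q : Measure Ω) (Z : ℕ → Ω → Fin N → ℝ) : Prop :=
  ∃ z : Fin N → ℝ, ∀ᵐ ω ∂Q, Tendsto (fun n => Z n ω) atTop (𝓝 z)

/-- The linear coefficient of the quadratic for the synchronization point. -/
def linCoeff (α β q θ xs : ℝ) : ℝ := (1 - α) * θ * xs - β * θ * q - (1 - α - β)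

/-- The discriminant of the quadratic. -/
def discr (α β q θ xs : ℝ) : ℝ :=
  linCoeff α β q θ xs ^ 2 + 4 * (1 - α) * β * θ ^ 2 * q * xs

/-- The root of the quadratic taken with the sign `+`. -/
def zHat (α β q θ xs : ℝ) : ℝ :=
  (-linCoeff α β q θ xs + √(discr α β q θ xs)) / (2 * (1 - α) * θ)

/-- The limit point; the second branch is the case `β = 0`. -/
def zInf (α β q θ xs : ℝ) : ℝ := if 0 < β then zHat α β q θ xs else (1 - θ * xs) / θ

/-- The probability `P̂`: `P(· | Z_0 ≠ 0)` when `β = 0` and `θ x* < 1`, and `P` otherwise. -/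
def pHat {N : ℕ} [MeasurableSpace Ω] (P : Measure Ω) (β θ xs : ℝ) (Z : ℕ → Ω → Fin N → ℝ) :
    Measure Ω :=
  if β = 0 ∧ θ * xs < 1 then ProbabilityTheory.cond P {ω | Z 0 ω ≠ 0} else P

end ReinforcedSystem

end

/-! Each component is a stochastic approximation: it moves by `r n` times a drift plus `r n` times a
bounded martingale difference. As `r n` is of order `1/n`, `∑ r n ^ 2 < ∞` makes the noise series
converge almost surely (`ae_exists_tendsto_weightedSum`), while `∑ r n = ∞` makes a drift of
constant sign decisive (`eventually_ge_of_drift`). What remains is mostly a deterministic statement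
about one trajectory (`IsPath`).

On a trajectory the range of the components is squeezed. Let `G x = α x + β q + (1 - α - β) f x -
x`. Since `f x / x` is nonincreasing, if all components are eventually above every level below `m`,
`G m > 0` and `α m + β q > 0`, then they are eventually above a level strictly larger than `m`
(`exists_lower_improvement`); `exists_upper_improvement` is the mirror image. Now `θ (x + x*) G x`
is a concave quadratic, positive between its smaller root and `z_∞` and negative beyond `z_∞`. So
the squeeze ends at `z_∞`, which gives synchronization and predictability at once.

If `β > 0`, the forcing `β q` starts the lower squeeze from `0`. If `β = 0` and `θ x* = 1`, then
`z_∞ = 0` and there is nothing to prove from below. If `β = 0` and `θ x* < 1`, then `0` is a second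
equilibrium and must be excluded. There `f' 0 > 1`, so near `0` the average `z` has a conditional
target at least `(1 + δ) z`. Suppose `z n → 0` from a nonzero start. The assumption on the products
gives `∑ z n = ∞`, and a martingale with bounded increments then forces `n z n` to be unbounded
(`ae_frequently_ge`). Next, `min 1 (K / (n z n))` is eventually a supermartingale, so `n z n > K`
eventually (`ae_eventually_gt`). Finally `1 / z n`, suitably killed, is a nonnegative
supermartingale and cannot diverge (`ae_not_tendsto_zero_of_eventually_gt`).

The empirical means obey a recursion with step `1 / (n + 1)` and track the targets, which converge
to `z_∞` (`tendsto_of_tracking`). -/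

noncomputable section

namespace ReinforcedSystem

/-! ### Real recursions with drift and convergent noise. -/

/-- A perturbed recursion whose drift is nonnegative below `c` and which visits `[c, ∞)` infinitely
often eventually stays above every level `c' < c`. -/
theorem eventually_ge_of_frequently_ge {x r g η : ℕ → ℝ} {B c c' s : ℝ}
    (hx : ∀ n, x n + r n * g n + η n ≤ x (n + 1)) (hr0 : ∀ n, 0 ≤ r n)
    (hr : Tendsto r atTop (𝓝 0))
    (hη : Tendsto (fun n => ∑ i ∈ Finset.range n, η i) atTop (𝓝 s))
    (hB : ∀ n, -B ≤ g n) (hg : ∀ᶠ n in atTop, x n ≤ c → 0 ≤ g n)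
    (hfreq : ∃ᶠ n in atTop, c ≤ x n) (hc : c' < c) : ∀ᶠ n in atTop, c' ≤ x n := by
  set e : ℕ → ℝ := fun n => (∑ i ∈ Finset.range n, η i) - s with he
  have he0 : Tendsto e atTop (𝓝 0) := by simpa [he] using hη.sub_const s
  have hesucc : ∀ n, e (n + 1) = e n + η n := fun n => by
    simp only [he, Finset.sum_range_succ]; ring
  have hrB : Tendsto (fun n => r n * B) atTop (𝓝 0) := by simpa using hr.mul_const B
  set ε := (c - c') / 4 with hε
  have hεpos : 0 < ε := by rw [hε]; linarith
  have h1 : ∀ᶠ n in atTop, |e n| < ε := by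
    have := he0.abs
    rw [abs_zero] at this
    exact this.eventually_lt_const hεpos
  have h2 : ∀ᶠ n in atTop, r n * B < ε := hrB.eventually_lt_const hεpos
  obtain ⟨n0, hn0⟩ := eventually_atTop.1 (h1.and (h2.and hg))
  obtain ⟨n1, hn1, hcn1⟩ := (frequently_atTop.1 hfreq) n0
  -- From `n1` on, `x - e` does not decrease in a step from `x n ≤ c`, and drops by less than `ε` in
  -- a step from `x n ≥ c`. Hence it stays above `c - 3ε`, and restoring `e` costs the fourth `ε`.
  have key : ∀ n, n1 ≤ n → c - 2 * ε - ε ≤ x n - e n := by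
    intro n hn
    induction n, hn using Nat.le_induction with
    | base => have := abs_lt.1 (hn0 n1 hn1).1; linarith
    | succ n hn ih =>
      obtain ⟨ha, hb, hgn⟩ := hn0 n (hn1.trans hn)
      have ha' := abs_lt.1 ha
      have hxn := hx n
      rw [hesucc]
      rcases le_total (x n) c with hle | hle
      · have := mul_nonneg (hr0 n) (hgn hle)
        linarith
      · have := mul_le_mul_of_nonneg_left (hB n) (hr0 n)
        linarith
  filter_upwards [eventually_ge_atTop n1] with n hn
  have := abs_lt.1 (hn0 n (hn1.trans hn)).1
  have := key n hn
  have : 4 * ε = c - c' := by rw [hε]; ring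
  linarith

/-- Were `x n < c` from some time on, the divergent `∑ r` would accumulate an infinite upward drift,
which convergent noise cannot offset. -/
theorem frequently_ge_of_drift {x r g η : ℕ → ℝ} {c δ s : ℝ}
    (hx : ∀ n, x n + r n * g n + η n ≤ x (n + 1)) (hr0 : ∀ n, 0 ≤ r n)
    (hdiv : ¬ Summable r)
    (hη : Tendsto (fun n => ∑ i ∈ Finset.range n, η i) atTop (𝓝 s))
    (hδ : 0 < δ) (hg : ∀ᶠ n in atTop, x n ≤ c → δ ≤ g n) : ∃ᶠ n in atTop, c ≤ x n := by
  intro hcon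
  obtain ⟨n0, hn0⟩ := eventually_atTop.1 (hcon.and hg)
  have key : ∀ n, n0 ≤ n → x n0 + δ * (∑ i ∈ Finset.range n, r i - ∑ i ∈ Finset.range n0, r i)
      + (∑ i ∈ Finset.range n, η i - ∑ i ∈ Finset.range n0, η i) ≤ x n := by
    intro n hn
    induction n, hn using Nat.le_induction with
    | base => simp
    | succ n hn ih =>
      obtain ⟨ha, hgn⟩ := hn0 n hn
      have := mul_le_mul_of_nonneg_left (hgn (not_le.1 ha).le) (hr0 n)
      have := hx n
      rw [Finset.sum_range_succ, Finset.sum_range_succ]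
      linarith
  have hT : Tendsto (fun n => ∑ i ∈ Finset.range n, r i) atTop atTop :=
    (not_summable_iff_tendsto_nat_atTop_of_nonneg hr0).1 hdiv
  have hT2 : Tendsto (fun n => (x n0 - δ * (∑ i ∈ Finset.range n0, r i)
      - ∑ i ∈ Finset.range n0, η i) + (δ * (∑ i ∈ Finset.range n, r i)
      + ∑ i ∈ Finset.range n, η i)) atTop atTop :=
    tendsto_atTop_add_const_left _ _ ((hT.const_mul_atTop hδ).atTop_add hη)
  obtain ⟨n, hn, hn'⟩ := ((hT2.eventually_gt_atTop c).and (eventually_ge_atTop n0)).exists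
  have := key n hn'
  have := not_le.1 (hn0 n hn').1
  linarith

theorem eventually_ge_of_drift {x r g η : ℕ → ℝ} {B c c' δ s : ℝ}
    (hx : ∀ n, x n + r n * g n + η n ≤ x (n + 1)) (hr0 : ∀ n, 0 ≤ r n)
    (hr : Tendsto r atTop (𝓝 0)) (hdiv : ¬ Summable r)
    (hη : Tendsto (fun n => ∑ i ∈ Finset.range n, η i) atTop (𝓝 s))
    (hB : ∀ n, -B ≤ g n) (hδ : 0 < δ) (hg : ∀ᶠ n in atTop, x n ≤ c → δ ≤ g n) (hc : c' < c) :
    ∀ᶠ n in atTop, c' ≤ x n :=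
  eventually_ge_of_frequently_ge hx hr0 hr hη hB
    (hg.mono fun _ h hle => hδ.le.trans (h hle)) (frequently_ge_of_drift hx hr0 hdiv hη hδ hg) hc

theorem eventually_le_of_drift {x r g η : ℕ → ℝ} {B c c' δ s : ℝ}
    (hx : ∀ n, x (n + 1) ≤ x n + r n * g n + η n) (hr0 : ∀ n, 0 ≤ r n)
    (hr : Tendsto r atTop (𝓝 0)) (hdiv : ¬ Summable r)
    (hη : Tendsto (fun n => ∑ i ∈ Finset.range n, η i) atTop (𝓝 s))
    (hB : ∀ n, g n ≤ B) (hδ : 0 < δ) (hg : ∀ᶠ n in atTop, c ≤ x n → g n ≤ -δ) (hc : c < c') :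
    ∀ᶠ n in atTop, x n ≤ c' := by
  have h := eventually_ge_of_drift (x := fun n => -x n) (r := r) (g := fun n => -g n)
    (η := fun n => -η n) (B := B) (c := -c) (c' := -c') (δ := δ) (s := -s)
    (fun n => by have := hx n; linarith) hr0 hr hdiv (by simpa using hη.neg)
    (fun n => neg_le_neg (hB n)) hδ
    (hg.mono fun n h hle => by have := h (by linarith); linarith) (by linarith)
  exact h.mono fun n hn => by linarith

/-- A recursion `x (n + 1) = x n + r n * (p n - x n) + η n` follows its target `p n → p∞`. -/
theorem tendsto_of_tracking {x r p η : ℕ → ℝ} {B l s : ℝ}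
    (hx : ∀ n, x (n + 1) = x n + r n * (p n - x n) + η n) (hr0 : ∀ n, 0 ≤ r n)
    (hr : Tendsto r atTop (𝓝 0)) (hdiv : ¬ Summable r)
    (hη : Tendsto (fun n => ∑ i ∈ Finset.range n, η i) atTop (𝓝 s))
    (hB : ∀ n, |p n - x n| ≤ B) (hp : Tendsto p atTop (𝓝 l)) : Tendsto x atTop (𝓝 l) := by
  refine tendsto_order.2 ⟨fun a ha => ?_, fun a ha => ?_⟩
  -- Once `p n > (a + 7l)/8`, every `x n ≤ (a + 3l)/4` leaves a drift of at least `(l - a)/8`; the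
  -- level reached, `(a + l)/2`, still exceeds `a`.
  · have h := eventually_ge_of_drift (c := (a + 3 * l) / 4) (c' := (a + l) / 2)
      (δ := (l - a) / 8) (fun n => (hx n).ge) hr0 hr hdiv hη (fun n => (abs_le.1 (hB n)).1)
      (by linarith)
      ((hp.eventually_const_lt (show (a + 7 * l) / 8 < l by linarith)).mono fun n hn hle => by
        linarith) (by linarith)
    exact h.mono fun n hn => by linarith
  · have h := eventually_le_of_drift (c := (a + 3 * l) / 4) (c' := (a + l) / 2)
      (δ := (a - l) / 8) (fun n => (hx n).le) hr0 hr hdiv hη (fun n => (abs_le.1 (hB n)).2)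
      (by linarith)
      ((hp.eventually_lt_const (show l < (a + 7 * l) / 8 by linarith)).mono fun n hn hle => by
        linarith) (by linarith)
    exact h.mono fun n hn => by linarith

/-! Step sizes of order `1 / n`. -/

theorem tendsto_zero_of_mul_tendsto {r : ℕ → ℝ}
    (hr : Tendsto (fun n : ℕ => (n : ℝ) * r n) atTop (𝓝 1)) : Tendsto r atTop (𝓝 0) := by
  have h := hr.mul (tendsto_inv_atTop_zero.comp (tendsto_natCast_atTop_atTop (R := ℝ)))
  rw [mul_zero] at h
  refine h.congr' ?_
  filter_upwards [eventually_gt_atTop 0] with n hn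
  have : (n : ℝ) ≠ 0 := by positivity
  simp only [Function.comp]
  field_simp

theorem not_summable_of_mul_tendsto {r : ℕ → ℝ}
    (hr : Tendsto (fun n : ℕ => (n : ℝ) * r n) atTop (𝓝 1)) : ¬ Summable r := by
  intro hs
  have h1 := hr.eventually_const_lt (show (1 / 2 : ℝ) < 1 by norm_num)
  obtain ⟨n0, hn0⟩ := eventually_atTop.1 (h1.and (eventually_gt_atTop 0))
  refine Real.not_summable_natCast_inv ?_
  rw [← summable_nat_add_iff n0] at hs ⊢
  refine Summable.of_nonneg_of_le (fun n => by positivity) (fun n => ?_) (hs.mul_left 2)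
  obtain ⟨ha, hb⟩ := hn0 (n + n0) (by omega)
  have : (0 : ℝ) < ((n + n0 : ℕ) : ℝ) := by exact_mod_cast hb
  rw [inv_le_iff_one_le_mul₀ this]
  linarith

theorem summable_sq_of_mul_tendsto {r : ℕ → ℝ} (hr0 : ∀ n, 0 ≤ r n)
    (hr : Tendsto (fun n : ℕ => (n : ℝ) * r n) atTop (𝓝 1)) : Summable fun n => r n ^ 2 := by
  have h1 := hr.eventually_lt_const (show (1 : ℝ) < 2 by norm_num)
  obtain ⟨n0, hn0⟩ := eventually_atTop.1 (h1.and (eventually_gt_atTop 0))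
  have hs : Summable fun n : ℕ => 4 * (((n : ℝ) ^ 2)⁻¹) :=
    (Real.summable_nat_pow_inv.2 (by norm_num)).mul_left 4
  rw [← summable_nat_add_iff n0] at hs ⊢
  refine Summable.of_nonneg_of_le (fun n => by positivity) (fun n => ?_) hs
  obtain ⟨ha, hb⟩ := hn0 (n + n0) (by omega)
  have hpos : (0 : ℝ) < ((n + n0 : ℕ) : ℝ) := by exact_mod_cast hb
  rw [← div_eq_mul_inv, le_div_iff₀ (by positivity), ← mul_pow]
  have := hr0 (n + n0)
  have h0 : 0 ≤ r (n + n0) * ((n + n0 : ℕ) : ℝ) := by positivity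
  nlinarith

/-! Elementary properties of the reinforcement function and of the synchronized drift. -/

/-- The drift of the system at the synchronized configuration `(x, …, x)`. -/
def netDrift (α κ γ : ℝ) (f : ℝ → ℝ) (x : ℝ) : ℝ := α * x + κ + γ * f x - x

section fLP

variable {θ xs : ℝ}

theorem fLP_nonneg (hθ : 0 < θ) (hxs : 0 < xs) {x : ℝ} (hx : 0 ≤ x) : 0 ≤ fLP θ xs x := by
  unfold fLP; positivity

theorem fLP_le_one (hθ : 0 < θ) (hxs : 0 < xs) (h : 1 - θ ≤ θ * xs) {x : ℝ} (hx : 0 ≤ x)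
    (hx1 : x ≤ 1) : fLP θ xs x ≤ 1 := by
  unfold fLP
  rw [div_le_one (by positivity)]
  nlinarith [mul_pos hθ hxs]

/-- The denominator grows with `x`, so `f x / x` decreases. Besides continuity, range bounds and the
signs of the net drift, the squeeze uses nothing else about `f`. -/
theorem fLP_mul_ge (hθ : 0 < θ) (hxs : 0 < xs) {t x : ℝ} (ht0 : 0 ≤ t) (ht1 : t ≤ 1)
    (hx : 0 ≤ x) : t * fLP θ xs x ≤ fLP θ xs (t * x) := by
  unfold fLP
  rw [← mul_div_assoc]
  have : t * x ≤ x := mul_le_of_le_one_left hx ht1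
  gcongr

theorem continuousAt_fLP (hθ : 0 < θ) (hxs : 0 < xs) {x : ℝ} (hx : 0 ≤ x) :
    ContinuousAt (fLP θ xs) x := by
  unfold fLP
  have : θ * (x + xs) ≠ 0 := by positivity
  fun_prop (disch := assumption)

theorem fLP_ge_of_le (hθ : 0 < θ) (hxs : 0 < xs) {x ε : ℝ} (hx : 0 ≤ x) (hxε : x ≤ ε) :
    (1 / (θ * (ε + xs))) * x ≤ fLP θ xs x := by
  unfold fLP
  rw [one_div_mul_eq_div]
  gcongr

end fLP

section signs

variable {α β q θ xs : ℝ}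

theorem mul_netDrift (hθ : 0 < θ) (hxs : 0 < xs) {x : ℝ} (hx : 0 ≤ x) :
    θ * (x + xs) * netDrift α (β * q) (1 - α - β) (fLP θ xs) x =
      -((1 - α) * θ * x ^ 2) - linCoeff α β q θ xs * x + β * q * θ * xs := by
  have : θ * (x + xs) ≠ 0 := by positivity
  have h2 : x + xs ≠ 0 := by positivity
  unfold netDrift fLP linCoeff
  field_simp
  ring

/-- The quadratic has negative leading coefficient and positive constant term, hence one positive
root `zHat` and one negative root `-w`; the signs come from `discr > b ^ 2`. -/
theorem mul_netDrift_zHat (hα1 : α < 1) (hβ : 0 < β) (hq0 : 0 < q)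
    (hθ : 0 < θ) (hxs : 0 < xs) : ∃ w, 0 < w ∧ 0 < zHat α β q θ xs ∧ ∀ x, 0 ≤ x →
    θ * (x + xs) * netDrift α (β * q) (1 - α - β) (fLP θ xs) x =
      (1 - α) * θ * (zHat α β q θ xs - x) * (x + w) := by
  have hα : 0 < 1 - α := by linarith
  set b := linCoeff α β q θ xs with hb
  have hpos : 0 < 4 * (1 - α) * β * θ ^ 2 * q * xs := by positivity
  have hD : discr α β q θ xs = b ^ 2 + 4 * (1 - α) * β * θ ^ 2 * q * xs := rfl
  have hs : √(discr α β q θ xs) ^ 2 = b ^ 2 + 4 * (1 - α) * β * θ ^ 2 * q * xs := by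
    rw [Real.sq_sqrt (by rw [hD]; positivity), hD]
  have habs : |b| < √(discr α β q θ xs) := by
    rw [← Real.sqrt_sq_eq_abs]
    exact Real.sqrt_lt_sqrt (sq_nonneg _) (by rw [hD]; linarith)
  have h12 := abs_lt.1 habs
  have hden : 0 < 2 * (1 - α) * θ := by positivity
  set S := √(discr α β q θ xs) with hS
  refine ⟨(b + S) / (2 * (1 - α) * θ), div_pos (by linarith) hden,
    div_pos (by rw [← hb, ← hS]; linarith) hden, fun x hx => ?_⟩
  rw [mul_netDrift hθ hxs hx, ← hb]
  have hz : zHat α β q θ xs = (-b + S) / (2 * (1 - α) * θ) := rfl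
  rw [hz]
  field_simp
  linear_combination (-1) * hs

theorem netDrift_one_le (hβ0 : 0 ≤ β) (hαβ1 : α + β < 1) (hq1 : q ≤ 1)
    (hθ : 0 < θ) (hxs : 0 < xs) (h : 1 - θ ≤ θ * xs) :
    netDrift α (β * q) (1 - α - β) (fLP θ xs) 1 ≤ 0 := by
  have h1 := fLP_le_one hθ hxs h zero_le_one le_rfl
  unfold netDrift
  nlinarith

theorem fLP_one_eq_one_iff (hθ : 0 < θ) (hxs : 0 < xs) :
    fLP θ xs 1 = 1 ↔ θ * xs = 1 - θ := by
  unfold fLP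
  rw [div_eq_one_iff_eq (by positivity)]
  constructor <;> intro h <;> linarith

/-- The net drift at `1` is `-(β (1 - q) + (1 - α - β) (1 - f 1))`. Both summands are nonnegative
with positive weights, so it vanishes only if both do. -/
theorem netDrift_one_eq_zero_iff (hβ : 0 < β) (hαβ1 : α + β < 1)
    (hq1 : q ≤ 1) (hθ : 0 < θ) (hxs : 0 < xs) (h : 1 - θ ≤ θ * xs) :
    netDrift α (β * q) (1 - α - β) (fLP θ xs) 1 = 0 ↔ q = 1 ∧ θ * xs = 1 - θ := by
  rw [← fLP_one_eq_one_iff hθ hxs]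
  have h1 := fLP_le_one hθ hxs h zero_le_one le_rfl
  unfold netDrift
  constructor
  · intro h0
    have ha : 0 ≤ β * (1 - q) := mul_nonneg hβ.le (by linarith)
    have hb : 0 ≤ (1 - α - β) * (1 - fLP θ xs 1) := mul_nonneg (by linarith) (by linarith)
    have ha' : β * (1 - q) = 0 := by nlinarith
    have hb' : (1 - α - β) * (1 - fLP θ xs 1) = 0 := by nlinarith
    rcases mul_eq_zero.1 ha' with h3 | h3
    · linarith
    · rcases mul_eq_zero.1 hb' with h4 | h4
      · linarith
      · exact ⟨by linarith, by linarith⟩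
  · rintro ⟨rfl, h2⟩
    rw [h2]; ring

/-- By the factorization at `x = 1`, `zHat - 1` has the sign of the net drift at `1`. -/
theorem zHat_properties (hα1 : α < 1) (hβ : 0 < β) (hαβ1 : α + β < 1)
    (hq0 : 0 < q) (hq1 : q ≤ 1) (hθ : 0 < θ) (hxs : 0 < xs) (h : 1 - θ ≤ θ * xs) :
    0 < zHat α β q θ xs ∧ zHat α β q θ xs ≤ 1 ∧
      (zHat α β q θ xs = 1 ↔ q = 1 ∧ θ * xs = 1 - θ) := by
  obtain ⟨w, hw, hz, hG⟩ := mul_netDrift_zHat hα1 hβ hq0 hθ hxs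
  have hα : 0 < 1 - α := by linarith
  have h1 := hG 1 zero_le_one
  have hp : 0 < θ * (1 + xs) := by positivity
  have hp' : 0 < (1 - α) * θ * (1 + w) := by positivity
  have h1' : θ * (1 + xs) * netDrift α (β * q) (1 - α - β) (fLP θ xs) 1 =
      (1 - α) * θ * (1 + w) * (zHat α β q θ xs - 1) := by rw [h1]; ring
  refine ⟨hz, ?_, ?_⟩
  · have h2 := mul_nonpos_of_nonneg_of_nonpos hp.le
      (netDrift_one_le hβ.le hαβ1 hq1 hθ hxs h)
    rw [h1'] at h2
    have := nonpos_of_mul_nonpos_right h2 hp'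
    linarith
  · rw [← netDrift_one_eq_zero_iff hβ hαβ1 hq1 hθ hxs h]
    constructor
    · intro h3
      rw [h3, sub_self, mul_zero] at h1'
      exact (mul_eq_zero.1 h1').resolve_left hp.ne'
    · intro h3
      rw [h3, mul_zero] at h1'
      have := (mul_eq_zero.1 h1'.symm).resolve_left hp'.ne'
      linarith

theorem zInf_nonneg (hα1 : α < 1) (hq0 : 0 < q) (hθ : 0 < θ)
    (hxs : 0 < xs) (hθxs1 : θ * xs ≤ 1) : 0 ≤ zInf α β q θ xs := by
  unfold zInf
  split_ifs with hβ
  · obtain ⟨w, hw, hz, -⟩ := mul_netDrift_zHat hα1 hβ hq0 hθ hxs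
    exact hz.le
  · exact div_nonneg (by linarith) hθ.le

theorem zInf_le_one (hα1 : α < 1) (hαβ1 : α + β < 1)
    (hq0 : 0 < q) (hq1 : q ≤ 1) (hθ : 0 < θ) (hxs : 0 < xs) (h : 1 - θ ≤ θ * xs) :
    zInf α β q θ xs ≤ 1 := by
  unfold zInf
  split_ifs with hβ
  · exact (zHat_properties hα1 hβ hαβ1 hq0 hq1 hθ hxs h).2.1
  · rw [div_le_one hθ]; linarith

/-- Factorization of the synchronized drift at the limit point. -/
theorem mul_netDrift_zInf (hα1 : α < 1) (hβ0 : 0 ≤ β) (hq0 : 0 < q) (hθ : 0 < θ)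
    (hxs : 0 < xs) : ∃ w, 0 ≤ w ∧ (0 < β → 0 < w) ∧ ∀ x, 0 ≤ x →
    θ * (x + xs) * netDrift α (β * q) (1 - α - β) (fLP θ xs) x =
      (1 - α) * θ * (zInf α β q θ xs - x) * (x + w) := by
  rcases hβ0.eq_or_lt with rfl | hβ
  · refine ⟨0, le_rfl, fun h => (lt_irrefl _ h).elim, fun x hx => ?_⟩
    rw [mul_netDrift hθ hxs hx]
    simp only [zInf, lt_irrefl, if_false, linCoeff]
    field_simp
    ring
  · obtain ⟨w, hw, hz, hG⟩ := mul_netDrift_zHat hα1 hβ hq0 hθ hxs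
    refine ⟨w, hw.le, fun _ => hw, fun x hx => ?_⟩
    rw [hG x hx, zInf, if_pos hβ]

theorem netDrift_zInf (hα1 : α < 1) (hβ0 : 0 ≤ β) (hq0 : 0 < q) (hθ : 0 < θ)
    (hxs : 0 < xs) (hθxs1 : θ * xs ≤ 1) :
    netDrift α (β * q) (1 - α - β) (fLP θ xs) (zInf α β q θ xs) = 0 := by
  obtain ⟨w, hw, -, hG⟩ := mul_netDrift_zInf hα1 hβ0 hq0 hθ hxs
  have hz := zInf_nonneg (β := β) hα1 hq0 hθ hxs hθxs1
  have := hG _ hz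
  rw [sub_self, mul_zero, zero_mul] at this
  exact (mul_eq_zero.1 this).resolve_left (by positivity)

/-- For `β = 0` the second root is `0`, itself an equilibrium; this is why `0 < β` or `0 < x` is
required. -/
theorem netDrift_pos_of_lt (hα1 : α < 1) (hβ0 : 0 ≤ β) (hq0 : 0 < q) (hθ : 0 < θ)
    (hxs : 0 < xs) {x : ℝ} (hx : 0 ≤ x) (hx' : 0 < β ∨ 0 < x) (hlt : x < zInf α β q θ xs) :
    0 < netDrift α (β * q) (1 - α - β) (fLP θ xs) x := by
  obtain ⟨w, hw, hwβ, hG⟩ := mul_netDrift_zInf hα1 hβ0 hq0 hθ hxs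
  have hα : 0 < 1 - α := by linarith
  have hxw : 0 < x + w := by
    rcases hx' with h | h
    · have := hwβ h; linarith
    · linarith
  have hp : 0 < (1 - α) * θ * (zInf α β q θ xs - x) * (x + w) :=
    mul_pos (mul_pos (mul_pos hα hθ) (by linarith)) hxw
  rw [← hG x hx] at hp
  exact pos_of_mul_pos_right hp (by positivity)

theorem netDrift_neg_of_gt (hα1 : α < 1) (hβ0 : 0 ≤ β) (hq0 : 0 < q) (hθ : 0 < θ)
    (hxs : 0 < xs) {x : ℝ} (hx : 0 < x) (hlt : zInf α β q θ xs < x) :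
    netDrift α (β * q) (1 - α - β) (fLP θ xs) x < 0 := by
  obtain ⟨w, hw, hwβ, hG⟩ := mul_netDrift_zInf hα1 hβ0 hq0 hθ hxs
  have hα : 0 < 1 - α := by linarith
  have hp : (1 - α) * θ * (zInf α β q θ xs - x) * (x + w) < 0 :=
    mul_neg_of_neg_of_pos (mul_neg_of_pos_of_neg (mul_pos hα hθ) (by linarith)) (by linarith)
  rw [← hG x hx.le] at hp
  exact neg_of_mul_neg_right hp (by positivity)

end signs

/-! ### Deterministic trajectories: squeezing the components. -/

theorem le_average {N : ℕ} (hN : 0 < N) {z : Fin N → ℝ} {c : ℝ} (h : ∀ i, c ≤ z i) :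
    c ≤ (∑ i, z i) / N := by
  rw [le_div_iff₀ (by exact_mod_cast hN)]
  calc c * N = ∑ _i : Fin N, c := by simp [mul_comm]
    _ ≤ _ := Finset.sum_le_sum fun i _ => h i

theorem average_le {N : ℕ} (hN : 0 < N) {z : Fin N → ℝ} {c : ℝ} (h : ∀ i, z i ≤ c) :
    (∑ i, z i) / N ≤ c := by
  rw [div_le_iff₀ (by exact_mod_cast hN)]
  calc _ ≤ ∑ _i : Fin N, c := Finset.sum_le_sum fun i _ => h i
    _ = c * N := by simp [mul_comm]

theorem le_mul_average {N : ℕ} (hN : 0 < N) {z : Fin N → ℝ} (h : ∀ i, 0 ≤ z i) (i : Fin N) :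
    z i ≤ N * ((∑ i, z i) / N) := by
  rw [mul_div_cancel₀ _ (by exact_mod_cast hN.ne')]
  exact Finset.single_le_sum (fun i _ => h i) (Finset.mem_univ i)

/-- A trajectory of the interacting system driven by a convergent noise series `η`. -/
structure IsPath {N : ℕ} (α κ γ : ℝ) (f : ℝ → ℝ) (r : ℕ → ℝ) (z η : ℕ → Fin N → ℝ) : Prop where
  card_pos : 0 < N
  nonneg : ∀ n h, 0 ≤ z n h
  le_one : ∀ n h, z n h ≤ 1
  step : ∀ n h, z (n + 1) h =
    z n h + r n * (α * ((∑ i, z n i) / N) + κ + γ * f (z n h) - z n h) + η n h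
  noise : ∀ h, ∃ s, Tendsto (fun n => ∑ k ∈ Finset.range n, η k h) atTop (𝓝 s)
  rate_nonneg : ∀ n, 0 ≤ r n
  rate_tendsto : Tendsto r atTop (𝓝 0)
  rate_div : ¬ Summable r
  alpha_nonneg : 0 ≤ α
  kappa_nonneg : 0 ≤ κ
  gamma_nonneg : 0 ≤ γ
  sum_le_one : α + κ + γ ≤ 1
  f_nonneg : ∀ x, 0 ≤ x → 0 ≤ f x
  f_le_one : ∀ x, 0 ≤ x → x ≤ 1 → f x ≤ 1
  f_mul_ge : ∀ t x, 0 ≤ t → t ≤ 1 → 0 ≤ x → t * f x ≤ f (t * x)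
  f_cont : ∀ x, 0 ≤ x → ContinuousAt f x

namespace IsPath

variable {N : ℕ} {α κ γ : ℝ} {f : ℝ → ℝ} {r : ℕ → ℝ} {z η : ℕ → Fin N → ℝ}

theorem target_mem (H : IsPath α κ γ f r z η) (n : ℕ) (h : Fin N) :
    0 ≤ α * ((∑ i, z n i) / N) + κ + γ * f (z n h) ∧
      α * ((∑ i, z n i) / N) + κ + γ * f (z n h) ≤ 1 := by
  have ha := le_average H.card_pos (H.nonneg n)
  have hb := average_le H.card_pos (H.le_one n)
  have hc := H.f_nonneg _ (H.nonneg n h)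
  have hd := H.f_le_one _ (H.nonneg n h) (H.le_one n h)
  have := mul_nonneg H.alpha_nonneg ha
  have := mul_nonneg H.gamma_nonneg hc
  have := mul_le_of_le_one_right H.alpha_nonneg hb
  have := mul_le_of_le_one_right H.gamma_nonneg hd
  exact ⟨by linarith [H.kappa_nonneg], by linarith [H.sum_le_one]⟩

theorem abs_drift_le (H : IsPath α κ γ f r z η) (n : ℕ) (h : Fin N) :
    |α * ((∑ i, z n i) / N) + κ + γ * f (z n h) - z n h| ≤ 1 := by
  have := H.target_mem n h
  have := H.nonneg n h
  have := H.le_one n h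
  exact abs_le.2 ⟨by linarith, by linarith⟩

/-- With all components above `m - ε`, one lying below `m + ε` feels a drift bounded below by a
positive constant: near `m + ε` because `G m > 0`, near `0` because `α m + κ > 0`, and in between by
interpolation. -/
theorem exists_lower_improvement (H : IsPath α κ γ f r z η) {m : ℝ} (hm0 : 0 ≤ m)
    (hm : ∀ c < m, ∀ᶠ n in atTop, ∀ h, c ≤ z n h) (hpos : 0 < α * m + κ)
    (hG : 0 < netDrift α κ γ f m) : ∃ c' > m, ∀ᶠ n in atTop, ∀ h, c' ≤ z n h := by
  have hlim1 : Tendsto (fun ε : ℝ => α * (m - ε) + κ) (𝓝 0) (𝓝 (α * m + κ)) := by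
    have : Continuous fun ε : ℝ => α * (m - ε) + κ := by fun_prop
    simpa using this.tendsto 0
  have hlim2 : Tendsto (fun ε : ℝ => α * (m - ε) + κ + (γ * f (m + ε) - (m + ε))) (𝓝 0)
      (𝓝 (netDrift α κ γ f m)) := by
    have hf : Tendsto (fun ε : ℝ => f (m + ε)) (𝓝 0) (𝓝 (f m)) := by
      refine (H.f_cont m hm0).tendsto.comp ?_
      have : Continuous fun ε : ℝ => m + ε := by fun_prop
      simpa using this.tendsto 0
    have hid : Tendsto (fun ε : ℝ => m + ε) (𝓝 0) (𝓝 m) := by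
      have : Continuous fun ε : ℝ => m + ε := by fun_prop
      simpa using this.tendsto 0
    have := hlim1.add ((hf.const_mul γ).sub hid)
    convert this using 2
    unfold netDrift; ring
  have hev := ((hlim1.eventually_const_lt hpos).and (hlim2.eventually_const_lt hG))
  obtain ⟨ε, ⟨h1, h2⟩, hε⟩ := ((hev.filter_mono nhdsWithin_le_nhds).and
    (self_mem_nhdsWithin (s := Set.Ioi (0 : ℝ)))).exists
  have hε : 0 < ε := hε
  set v := α * (m - ε) + κ + (γ * f (m + ε) - (m + ε)) with hv
  set δ := min (α * (m - ε) + κ) v with hδ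
  have hδ0 : 0 < δ := lt_min h1 h2
  refine ⟨m + ε / 2, by linarith, ?_⟩
  rw [eventually_all]
  intro h
  obtain ⟨s, hs⟩ := H.noise h
  refine eventually_ge_of_drift (x := fun n => z n h) (c := m + ε) (fun n => (H.step n h).ge)
    H.rate_nonneg H.rate_tendsto H.rate_div hs (fun n => (abs_le.1 (H.abs_drift_le n h)).1)
    hδ0 ?_ (by linarith)
  filter_upwards [hm (m - ε) (by linarith)] with n hn hle
  have ha := mul_le_mul_of_nonneg_left (le_average H.card_pos hn) H.alpha_nonneg
  have hmε : 0 < m + ε := by linarith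
  -- Writing `z n h = t (m + ε)` bounds the drift below by `(1 - t) (α (m - ε) + κ) + t v`, a convex
  -- combination of two numbers that are at least `δ`.
  set t := z n h / (m + ε) with ht
  have ht0 : 0 ≤ t := div_nonneg (H.nonneg n h) hmε.le
  have ht1 : t ≤ 1 := (div_le_one hmε).2 hle
  have hzt : t * (m + ε) = z n h := div_mul_cancel₀ _ hmε.ne'
  have hf := mul_le_mul_of_nonneg_left (H.f_mul_ge t (m + ε) ht0 ht1 hmε.le) H.gamma_nonneg
  rw [hzt] at hf
  have e1 := mul_le_mul_of_nonneg_left (min_le_left (α * (m - ε) + κ) v) (sub_nonneg.2 ht1)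
  have e2 := mul_le_mul_of_nonneg_left (min_le_right (α * (m - ε) + κ) v) ht0
  rw [← hδ] at e1 e2
  have e3 : (1 - t) * (α * (m - ε) + κ) + t * v =
      (α * (m - ε) + κ) + γ * (t * f (m + ε)) - z n h := by
    rw [← hzt, hv]; ring
  linarith

theorem exists_upper_improvement (H : IsPath α κ γ f r z η) {m : ℝ} (hm0 : 0 < m)
    (hm : ∀ c > m, ∀ᶠ n in atTop, ∀ h, z n h ≤ c)
    (hG : netDrift α κ γ f m < 0) : ∃ c' < m, ∀ᶠ n in atTop, ∀ h, z n h ≤ c' := by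
  have hid : Tendsto (fun ε : ℝ => m - ε) (𝓝 0) (𝓝 m) := by
    have : Continuous fun ε : ℝ => m - ε := by fun_prop
    simpa using this.tendsto 0
  have hlim2 : Tendsto (fun ε : ℝ => α * (m + ε) + κ + (γ * f (m - ε) - (m - ε))) (𝓝 0)
      (𝓝 (netDrift α κ γ f m)) := by
    have hlim1 : Tendsto (fun ε : ℝ => α * (m + ε) + κ) (𝓝 0) (𝓝 (α * m + κ)) := by
      have : Continuous fun ε : ℝ => α * (m + ε) + κ := by fun_prop
      simpa using this.tendsto 0
    have hf : Tendsto (fun ε : ℝ => f (m - ε)) (𝓝 0) (𝓝 (f m)) :=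
      (H.f_cont m hm0.le).tendsto.comp hid
    have := hlim1.add ((hf.const_mul γ).sub hid)
    convert this using 2
    unfold netDrift; ring
  have hev := ((hid.eventually_const_lt hm0).and (hlim2.eventually_lt_const hG))
  obtain ⟨ε, ⟨h1, h2⟩, hε⟩ := ((hev.filter_mono nhdsWithin_le_nhds).and
    (self_mem_nhdsWithin (s := Set.Ioi (0 : ℝ)))).exists
  have hε : 0 < ε := hε
  set v := α * (m + ε) + κ + (γ * f (m - ε) - (m - ε)) with hv
  refine ⟨m - ε / 2, by linarith, ?_⟩
  rw [eventually_all]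
  intro h
  obtain ⟨s, hs⟩ := H.noise h
  refine eventually_le_of_drift (x := fun n => z n h) (c := m - ε) (δ := -v)
    (fun n => (H.step n h).le)
    H.rate_nonneg H.rate_tendsto H.rate_div hs (fun n => (abs_le.1 (H.abs_drift_le n h)).2)
    (by linarith) ?_ (by linarith)
  filter_upwards [hm (m + ε) (by linarith)] with n hn hle
  have ha := mul_le_mul_of_nonneg_left (average_le H.card_pos hn) H.alpha_nonneg
  have hz : 0 < z n h := by linarith
  set t := (m - ε) / z n h with ht
  have ht0 : 0 < t := div_pos h1 hz
  have ht1 : t ≤ 1 := (div_le_one hz).2 hle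
  have hzt : t * z n h = m - ε := div_mul_cancel₀ _ hz.ne'
  have hf := mul_le_mul_of_nonneg_left (H.f_mul_ge t (z n h) ht0.le ht1 hz.le) H.gamma_nonneg
  rw [hzt] at hf
  have hA : 0 ≤ α * (m + ε) + κ :=
    add_nonneg (mul_nonneg H.alpha_nonneg (by linarith)) H.kappa_nonneg
  have e3 : t * (γ * f (z n h) - z n h) ≤ v - (α * (m + ε) + κ) := by
    rw [mul_sub, hzt, hv]; linarith
  -- The right-hand side is negative and `0 < t ≤ 1`, so removing the factor `t` preserves the
  -- bound.
  have e4 : γ * f (z n h) - z n h ≤ v - (α * (m + ε) + κ) := by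
    by_contra hcon
    push Not at hcon
    have e5 := mul_lt_mul_of_pos_left hcon ht0
    have e6 := mul_le_mul_of_nonneg_right ht1
      (show 0 ≤ -(v - (α * (m + ε) + κ)) by linarith)
    linarith
  linarith

/-- If the supremum of the eventual common lower bounds were below `ζ`, it could be improved.
Starting from `c0` keeps `α m + κ` positive there. -/
theorem eventually_ge (H : IsPath α κ γ f r z η) {c0 ζ : ℝ} (hc0 : 0 ≤ c0)
    (hpos : 0 < α * c0 + κ) (hev : ∀ᶠ n in atTop, ∀ h, c0 ≤ z n h)
    (hG : ∀ x, c0 ≤ x → x < ζ → 0 < netDrift α κ γ f x) :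
    ∀ c < ζ, ∀ᶠ n in atTop, ∀ h, c ≤ z n h := by
  set S := {c : ℝ | ∀ᶠ n in atTop, ∀ h, c ≤ z n h} with hS
  have hbdd : BddAbove S := by
    refine ⟨1, fun c hc => ?_⟩
    obtain ⟨n, hn⟩ := Eventually.exists hc
    exact (hn ⟨0, H.card_pos⟩).trans (H.le_one _ _)
  have hlt : ∀ c < sSup S, ∀ᶠ n in atTop, ∀ h, c ≤ z n h := by
    intro c hc
    obtain ⟨c', hc', hcc'⟩ := exists_lt_of_lt_csSup ⟨c0, hev⟩ hc
    exact Eventually.mono hc' fun n hn h => hcc'.le.trans (hn h)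
  have hm : c0 ≤ sSup S := le_csSup hbdd hev
  suffices ζ ≤ sSup S from fun c hc => hlt c (hc.trans_le this)
  by_contra hcon
  push Not at hcon
  obtain ⟨c', hc', hev'⟩ := H.exists_lower_improvement (hc0.trans hm) hlt
    (by have := mul_le_mul_of_nonneg_left hm H.alpha_nonneg; linarith) (hG _ hm hcon)
  exact absurd (le_csSup hbdd hev') (not_le.2 hc')

theorem eventually_le (H : IsPath α κ γ f r z η) {ζ : ℝ} (hζ : 0 ≤ ζ)
    (hG : ∀ x, ζ < x → netDrift α κ γ f x < 0) :
    ∀ c > ζ, ∀ᶠ n in atTop, ∀ h, z n h ≤ c := by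
  set S := {c : ℝ | ∀ᶠ n in atTop, ∀ h, z n h ≤ c} with hS
  have hbdd : BddBelow S := by
    refine ⟨0, fun c hc => ?_⟩
    obtain ⟨n, hn⟩ := Eventually.exists hc
    exact (H.nonneg _ _).trans (hn ⟨0, H.card_pos⟩)
  have hne : S.Nonempty := ⟨1, Eventually.of_forall H.le_one⟩
  have hlt : ∀ c > sInf S, ∀ᶠ n in atTop, ∀ h, z n h ≤ c := by
    intro c hc
    obtain ⟨c', hc', hcc'⟩ := exists_lt_of_csInf_lt hne hc
    exact Eventually.mono hc' fun n hn h => (hn h).trans hcc'.le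
  suffices sInf S ≤ ζ from fun c hc => hlt c (this.trans_lt hc)
  by_contra hcon
  push Not at hcon
  obtain ⟨c', hc', hev'⟩ := H.exists_upper_improvement (hζ.trans_lt hcon) hlt (hG _ hcon)
  exact absurd (csInf_le hbdd hev') (not_le.2 hc')

theorem average_step (H : IsPath α κ γ f r z η) (n : ℕ) : (∑ i, z (n + 1) i) / N =
    (∑ i, z n i) / N + r n * ((∑ h, (α * ((∑ i, z n i) / N) + κ + γ * f (z n h))) / N
      - (∑ i, z n i) / N) + (∑ i, η n i) / N := by
  have key : ∀ t : Fin N → ℝ, (∀ h, z (n + 1) h = z n h + r n * (t h - z n h) + η n h) →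
      (∑ i, z (n + 1) i) / N = (∑ i, z n i) / N + r n * ((∑ h, t h) / N
        - (∑ i, z n i) / N) + (∑ i, η n i) / N := by
    intro t ht
    simp_rw [ht, Finset.sum_add_distrib, ← Finset.mul_sum, Finset.sum_sub_distrib]
    ring
  exact key _ (H.step n)

theorem noise_average (H : IsPath α κ γ f r z η) :
    ∃ s, Tendsto (fun n => ∑ k ∈ Finset.range n, (∑ i, η k i) / N) atTop (𝓝 s) := by
  choose s hs using H.noise
  refine ⟨(∑ i, s i) / N, ?_⟩
  have := (tendsto_finsetSum Finset.univ fun i _ => hs i).div_const (N : ℝ)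
  refine this.congr fun n => ?_
  rw [Finset.sum_comm, Finset.sum_div]

/-- If the average target exceeds the average near `0`, then the average inclination either
vanishes in the limit or is eventually bounded away from `0`. -/
theorem average_tendsto_zero_or_eventually_ge (H : IsPath α κ γ f r z η) {ε : ℝ} (hε : 0 < ε)
    (hrep : ∀ n, (∑ i, z n i) / N ≤ ε →
      (∑ i, z n i) / N ≤ (∑ h, (α * ((∑ i, z n i) / N) + κ + γ * f (z n h))) / N) :
    Tendsto (fun n => (∑ i, z n i) / N) atTop (𝓝 0) ∨
      ∃ c > 0, ∀ᶠ n in atTop, c ≤ (∑ i, z n i) / N := by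
  refine or_iff_not_imp_left.2 fun hnot => ?_
  have : ∃ c > 0, ∃ᶠ n in atTop, c ≤ (∑ i, z n i) / N := by
    by_contra hcon
    push Not at hcon
    refine hnot (tendsto_order.2 ⟨fun a ha => Eventually.of_forall fun n =>
      ha.trans_le (le_average H.card_pos (H.nonneg n)), fun a ha => ?_⟩)
    exact (hcon a ha)
  obtain ⟨c, hc, hfr⟩ := this
  obtain ⟨s, hs⟩ := H.noise_average
  have hc' : 0 < min c ε := lt_min hc hε
  refine ⟨min c ε / 2, by linarith, ?_⟩
  refine eventually_ge_of_frequently_ge (c := min c ε) (B := 1)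
    (fun n => (H.average_step n).ge) H.rate_nonneg H.rate_tendsto hs (fun n => ?_)
    (Eventually.of_forall fun n hn => sub_nonneg.2 (hrep n (hn.trans (min_le_right _ _))))
    (hfr.mono fun n hn => (min_le_left _ _).trans hn) (by linarith)
  have h1 := le_average H.card_pos fun h => (H.target_mem n h).1
  have h2 := average_le H.card_pos (H.le_one n)
  linarith

/-- Once the average is bounded away from `0`, so is every component, provided `0 < α`. -/
theorem eventually_ge_of_average_ge (H : IsPath α κ γ f r z η) (hα : 0 < α) {c : ℝ} (hc : 0 < c)
    (hev : ∀ᶠ n in atTop, c ≤ (∑ i, z n i) / N) :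
    ∃ c' > 0, ∀ᶠ n in atTop, ∀ h, c' ≤ z n h := by
  have hαc : 0 < α * c := mul_pos hα hc
  refine ⟨α * c / 4, by linarith, ?_⟩
  rw [eventually_all]
  intro h
  obtain ⟨s, hs⟩ := H.noise h
  -- Below `α c / 2` the interaction term alone, at least `α c`, leaves a drift of at least `α c /
  -- 2`.
  refine eventually_ge_of_drift (x := fun n => z n h) (c := α * c / 2) (δ := α * c / 2)
    (fun n => (H.step n h).ge)
    H.rate_nonneg H.rate_tendsto H.rate_div hs (fun n => (abs_le.1 (H.abs_drift_le n h)).1)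
    (by linarith) ?_ (by linarith)
  filter_upwards [hev] with n hn hle
  have := mul_le_mul_of_nonneg_left hn hα.le
  have := mul_nonneg H.gamma_nonneg (H.f_nonneg _ (H.nonneg n h))
  linarith [H.kappa_nonneg]

end IsPath

/-! ### Almost sure convergence of martingales and supermartingales. -/

section martingales

variable {Ω : Type*} {mΩ : MeasurableSpace Ω} {μ : Measure Ω} [IsProbabilityMeasure μ]
  {ℱ : Filtration ℕ mΩ}

theorem integrable_of_abs_le {X : Ω → ℝ} (hX : StronglyMeasurable X) {C : ℝ}
    (hC : ∀ ω, |X ω| ≤ C) : Integrable X μ :=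
  Integrable.of_bound hX.aestronglyMeasurable C (Eventually.of_forall hC)

variable {ξ : ℕ → Ω → ℝ}

theorem stronglyMeasurable_weightedSum (hξ : ∀ n, StronglyMeasurable[ℱ (n + 1)] (ξ n))
    (w : ℕ → ℝ) (n : ℕ) :
    StronglyMeasurable[ℱ n] fun ω => ∑ k ∈ Finset.range n, w k * ξ k ω := by
  refine Finset.stronglyMeasurable_fun_sum _ fun k hk => ?_
  exact ((hξ k).mono (ℱ.mono (Finset.mem_range.1 hk))).const_mul (w k)

theorem abs_weightedSum_le (hb : ∀ n ω, |ξ n ω| ≤ 1) (w : ℕ → ℝ) (n : ℕ) (ω : Ω) :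
    |∑ k ∈ Finset.range n, w k * ξ k ω| ≤ ∑ k ∈ Finset.range n, |w k| := by
  refine (Finset.abs_sum_le_sum_abs _ _).trans (Finset.sum_le_sum fun k _ => ?_)
  rw [abs_mul]
  exact mul_le_of_le_one_right (abs_nonneg _) (hb k ω)

theorem martingale_weightedSum (hξ : ∀ n, StronglyMeasurable[ℱ (n + 1)] (ξ n))
    (hb : ∀ n ω, |ξ n ω| ≤ 1) (h0 : ∀ n, μ[ξ n | ℱ n] =ᵐ[μ] 0) (w : ℕ → ℝ) :
    Martingale (fun n ω => ∑ k ∈ Finset.range n, w k * ξ k ω) ℱ μ := by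
  refine martingale_of_condExp_sub_eq_zero_nat (stronglyMeasurable_weightedSum hξ w)
    (fun n => integrable_of_abs_le ((stronglyMeasurable_weightedSum hξ w n).mono (ℱ.le n))
      (abs_weightedSum_le hb w n)) fun n => ?_
  have : (fun ω => ∑ k ∈ Finset.range (n + 1), w k * ξ k ω) -
      (fun ω => ∑ k ∈ Finset.range n, w k * ξ k ω) = w n • ξ n := by
    ext ω
    simp [Finset.sum_range_succ]
  rw [this]
  filter_upwards [condExp_smul (μ := μ) (w n) (ξ n) (ℱ n), h0 n] with ω h1 h2
  rw [h1]
  simp [h2]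

theorem integral_mul_noise_eq_zero (hξ : ∀ n, StronglyMeasurable[ℱ (n + 1)] (ξ n))
    (hb : ∀ n ω, |ξ n ω| ≤ 1) (h0 : ∀ n, μ[ξ n | ℱ n] =ᵐ[μ] 0) {n : ℕ} {M : Ω → ℝ}
    (hM : StronglyMeasurable[ℱ n] M) {C : ℝ} (hC : ∀ ω, |M ω| ≤ C) :
    ∫ ω, M ω * ξ n ω ∂μ = 0 := by
  have hint : Integrable (ξ n) μ := integrable_of_abs_le ((hξ n).mono (ℱ.le _)) (hb n)
  have h1 := condExp_stronglyMeasurable_mul_of_bound (ℱ.le n) hM hint C (Eventually.of_forall hC)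
  calc ∫ ω, M ω * ξ n ω ∂μ = ∫ ω, (μ[M * ξ n | ℱ n]) ω ∂μ := (integral_condExp (ℱ.le n)).symm
    _ = ∫ ω, (0 : ℝ) ∂μ := by
        refine integral_congr_ae ?_
        filter_upwards [h1, h0 n] with ω h1 h2
        rw [h1, Pi.mul_apply, h2]
        simp
    _ = 0 := by simp

/-- Martingale increments are orthogonal, so the cross terms vanish and the second moments add up.
-/
theorem integral_sq_weightedSum_le (hξ : ∀ n, StronglyMeasurable[ℱ (n + 1)] (ξ n))
    (hb : ∀ n ω, |ξ n ω| ≤ 1) (h0 : ∀ n, μ[ξ n | ℱ n] =ᵐ[μ] 0) (w : ℕ → ℝ) (n : ℕ) :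
    ∫ ω, (∑ k ∈ Finset.range n, w k * ξ k ω) ^ 2 ∂μ ≤ ∑ k ∈ Finset.range n, w k ^ 2 := by
  induction n with
  | zero => simp
  | succ n ih =>
    set M : Ω → ℝ := fun ω => ∑ k ∈ Finset.range n, w k * ξ k ω with hM
    have hMm : StronglyMeasurable[ℱ n] M := stronglyMeasurable_weightedSum hξ w n
    have hMb : ∀ ω, |M ω| ≤ ∑ k ∈ Finset.range n, |w k| := abs_weightedSum_le hb w n
    set C := ∑ k ∈ Finset.range n, |w k|
    have hMm' : StronglyMeasurable M := hMm.mono (ℱ.le n)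
    have hξm : StronglyMeasurable (ξ n) := (hξ n).mono (ℱ.le _)
    have hC0 : 0 ≤ C := Finset.sum_nonneg fun _ _ => abs_nonneg _
    have i1 : Integrable (fun ω => M ω ^ 2) μ :=
      integrable_of_abs_le (hMm'.pow 2) (C := C ^ 2) fun ω => by
        rw [abs_pow]; exact pow_le_pow_left₀ (abs_nonneg _) (hMb ω) 2
    have i2 : Integrable (fun ω => 2 * w n * (M ω * ξ n ω)) μ := by
      refine (integrable_of_abs_le (hMm'.mul hξm) (C := C * 1) fun ω => ?_).const_mul _
      rw [Pi.mul_apply, abs_mul]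
      exact mul_le_mul (hMb ω) (hb n ω) (abs_nonneg _) hC0
    have i3 : Integrable (fun ω => w n ^ 2 * ξ n ω ^ 2) μ := by
      refine (integrable_of_abs_le (hξm.pow 2) (C := 1) fun ω => ?_).const_mul _
      rw [Pi.pow_apply, abs_pow]
      exact pow_le_one₀ (abs_nonneg _) (hb n ω)
    have hexp : ∀ ω, (∑ k ∈ Finset.range (n + 1), w k * ξ k ω) ^ 2 =
        M ω ^ 2 + 2 * w n * (M ω * ξ n ω) + w n ^ 2 * ξ n ω ^ 2 := fun ω => by
      rw [Finset.sum_range_succ]; simp only [hM]; ring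
    have h3 : ∫ ω, ξ n ω ^ 2 ∂μ ≤ 1 := by
      calc ∫ ω, ξ n ω ^ 2 ∂μ ≤ ∫ _ω, (1 : ℝ) ∂μ := by
            refine integral_mono_of_nonneg (Eventually.of_forall fun ω => sq_nonneg _)
              (integrable_const 1) (Eventually.of_forall fun ω => ?_)
            exact (sq_le_one_iff_abs_le_one _).2 (hb n ω)
        _ = 1 := by simp
    simp_rw [hexp]
    have i12 : Integrable (fun ω => M ω ^ 2 + 2 * w n * (M ω * ξ n ω)) μ := i1.add i2
    rw [integral_add i12 i3, integral_add i1 i2, integral_const_mul, integral_const_mul,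
      integral_mul_noise_eq_zero hξ hb h0 hMm hMb, Finset.sum_range_succ]
    have := mul_le_mul_of_nonneg_left h3 (sq_nonneg (w n))
    linarith

/-- A noise series with square-summable weights converges almost surely. -/
theorem ae_exists_tendsto_weightedSum (hξ : ∀ n, StronglyMeasurable[ℱ (n + 1)] (ξ n))
    (hb : ∀ n ω, |ξ n ω| ≤ 1) (h0 : ∀ n, μ[ξ n | ℱ n] =ᵐ[μ] 0) {w : ℕ → ℝ}
    (hw : Summable fun n => w n ^ 2) :
    ∀ᵐ ω ∂μ, ∃ s, Tendsto (fun n => ∑ k ∈ Finset.range n, w k * ξ k ω) atTop (𝓝 s) := by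
  refine (martingale_weightedSum hξ hb h0 w).submartingale.exists_ae_tendsto_of_bdd
    (R := (1 + ∑' n, w n ^ 2).toNNReal) fun n => ?_
  have hm : StronglyMeasurable fun ω => ∑ k ∈ Finset.range n, w k * ξ k ω :=
    (stronglyMeasurable_weightedSum hξ w n).mono (ℱ.le n)
  have hbd := abs_weightedSum_le hb w n
  have hint : Integrable (fun ω => ∑ k ∈ Finset.range n, w k * ξ k ω) μ :=
    integrable_of_abs_le hm hbd
  have hint2 : Integrable (fun ω => (∑ k ∈ Finset.range n, w k * ξ k ω) ^ 2) μ :=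
    integrable_of_abs_le (hm.pow 2) (C := (∑ k ∈ Finset.range n, |w k|) ^ 2) fun ω => by
      rw [abs_pow]; exact pow_le_pow_left₀ (abs_nonneg _) (hbd ω) 2
  rw [eLpNorm_one_eq_lintegral_enorm, ← ofReal_integral_norm_eq_lintegral_enorm hint]
  change _ ≤ ENNReal.ofReal _
  refine ENNReal.ofReal_le_ofReal ?_
  -- The `L²` bound gives the `L¹` bound needed for convergence through `|M| ≤ 1 + M ^ 2`.
  calc ∫ ω, ‖∑ k ∈ Finset.range n, w k * ξ k ω‖ ∂μ
      ≤ ∫ ω, (1 + (∑ k ∈ Finset.range n, w k * ξ k ω) ^ 2) ∂μ := by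
        refine integral_mono hint.norm ((integrable_const 1).add hint2) fun ω => ?_
        simp only [Real.norm_eq_abs]
        rw [← sq_abs]
        nlinarith [sq_nonneg (|∑ k ∈ Finset.range n, w k * ξ k ω| - 1),
          abs_nonneg (∑ k ∈ Finset.range n, w k * ξ k ω)]
    _ = 1 + ∫ ω, (∑ k ∈ Finset.range n, w k * ξ k ω) ^ 2 ∂μ := by
        rw [integral_add (integrable_const 1) hint2]; simp
    _ ≤ 1 + ∑' n, w n ^ 2 := by
        have := integral_sq_weightedSum_le hξ hb h0 w n
        have := hw.sum_le_tsum (Finset.range n) fun i _ => sq_nonneg (w i)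
        linarith

/-- A nonnegative supermartingale converges almost surely. -/
theorem ae_exists_tendsto_of_supermartingale {X : ℕ → Ω → ℝ} (hX : Supermartingale X ℱ μ)
    (h0 : ∀ n ω, 0 ≤ X n ω) : ∀ᵐ ω ∂μ, ∃ c, Tendsto (fun n => X n ω) atTop (𝓝 c) := by
  have h := hX.neg.exists_ae_tendsto_of_bdd (R := (∫ ω, X 0 ω ∂μ).toNNReal) fun n => by
    rw [eLpNorm_one_eq_lintegral_enorm,
      ← ofReal_integral_norm_eq_lintegral_enorm (hX.neg.integrable n)]
    change _ ≤ ENNReal.ofReal _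
    refine ENNReal.ofReal_le_ofReal ?_
    have hn := hX.setIntegral_le (Nat.zero_le n) (s := Set.univ) MeasurableSet.univ
    rw [setIntegral_univ, setIntegral_univ] at hn
    refine le_trans (le_of_eq (integral_congr_ae (Eventually.of_forall fun ω => ?_))) hn
    simp [abs_of_nonneg (h0 n ω)]
  filter_upwards [h] with ω hω
  obtain ⟨c, hc⟩ := hω
  exact ⟨-c, by simpa using hc.neg⟩

/-- One-step bound: an affine majorant with past-measurable coefficients may be evaluated at the
conditional mean. -/
theorem condExp_le_of_le_affine {m : MeasurableSpace Ω} (hm : m ≤ mΩ) {Y a b u p X : Ω → ℝ}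
    {A B : ℝ} (hY : Integrable Y μ) (ha : StronglyMeasurable[m] a) (hb : StronglyMeasurable[m] b)
    (hA : ∀ ω, |a ω| ≤ A) (hB : ∀ ω, |b ω| ≤ B) (hu : Integrable u μ)
    (hp : μ[u | m] =ᵐ[μ] p) (hle : ∀ ω, Y ω ≤ a ω - b ω * u ω)
    (hX : ∀ ω, a ω - b ω * p ω ≤ X ω) : μ[Y | m] ≤ᵐ[μ] X := by
  have ia : Integrable a μ := integrable_of_abs_le (ha.mono hm) hA
  have ib : Integrable (b * u) μ :=
    hu.bdd_mul (hb.mono hm).aestronglyMeasurable (Eventually.of_forall hB)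
  have h1 : μ[Y | m] ≤ᵐ[μ] μ[a - b * u | m] :=
    condExp_mono hY (ia.sub ib) (Eventually.of_forall hle)
  have h2 := condExp_sub ia ib m
  have h3 := condExp_stronglyMeasurable_mul_of_bound hm hb hu B (Eventually.of_forall hB)
  have h4 := condExp_of_stronglyMeasurable hm ha ia
  filter_upwards [h1, h2, h3, hp] with ω h1 h2 h3 h5
  refine h1.trans ?_
  rw [h2, Pi.sub_apply, h3, Pi.mul_apply, h4, h5]
  exact hX ω

end martingales

/-! ### Non-extinction of a repulsive scalar scheme. -/

/-- The reciprocal of a convex combination lies below the chord. -/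
theorem inv_step_le {x r u : ℝ} (hx : 0 < x) (hr0 : 0 ≤ r) (hr1 : r < 1) (hu0 : 0 ≤ u)
    (hu1 : u ≤ 1) : 1 / ((1 - r) * x + r * u) ≤
      1 / ((1 - r) * x) - 1 / ((1 - r) * x) * (r / ((1 - r) * x + r)) * u := by
  have hA : 0 < (1 - r) * x := mul_pos (by linarith) hx
  generalize (1 - r) * x = A at hA
  have h1 : 0 < A + r := by linarith
  have h2 : 0 < A + r * u := by positivity
  rw [div_le_iff₀ h2]
  have : (1 / A - 1 / A * (r / (A + r)) * u) * (A + r * u) =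
      1 + r ^ 2 * (u * (1 - u)) / (A * (A + r)) := by
    field_simp; ring
  rw [this]
  have := mul_nonneg hu0 (sub_nonneg.2 hu1)
  have : 0 ≤ r ^ 2 * (u * (1 - u)) / (A * (A + r)) := by positivity
  linarith

/-- The condition `K r ≤ 2 x` comes from `n x ≥ K` and `n r ≤ 2`. It gives `r ≤ (2 / K) x`, so
replacing the denominator by `x` costs only the factor `1 + 2 / K`. -/
theorem mul_weight_ge {x r p l K : ℝ} (hx : 0 < x) (hr0 : 0 ≤ r) (hr1 : r < 1) (hl : 0 ≤ l)
    (hK : 0 < K) (hrx : K * r ≤ 2 * x) (hp : l * x ≤ p) :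
    l * r / (1 + 2 / K) ≤ r / ((1 - r) * x + r) * p := by
  have hA : 0 < (1 - r) * x := mul_pos (by linarith) hx
  have hle : r ≤ 2 / K * x := by
    rw [div_mul_eq_mul_div, le_div_iff₀ hK]; linarith
  have h1 : (1 - r) * x + r ≤ (1 + 2 / K) * x := by
    have := mul_nonneg hr0 hx.le
    linarith
  calc l * r / (1 + 2 / K) = r / ((1 + 2 / K) * x) * (l * x) := by field_simp
    _ ≤ r / ((1 - r) * x + r) * p := by gcongr

section

variable {Ω : Type*} {mΩ : MeasurableSpace Ω}

/-- A scalar reinforcement scheme `z (n + 1) = (1 - r n) z n + r n u n` whose conditional success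
probability `p` dominates `c z`, and dominates `(1 + δ) z` as long as `z ≤ ε`. -/
structure IsScalarScheme (μ : Measure Ω) (ℱ : Filtration ℕ mΩ) (r : ℕ → ℝ) (z u p : ℕ → Ω → ℝ)
    (c δ ε : ℝ) : Prop where
  z_meas : ∀ n, StronglyMeasurable[ℱ n] (z n)
  p_meas : ∀ n, StronglyMeasurable[ℱ n] (p n)
  u_meas : ∀ n, StronglyMeasurable[ℱ (n + 1)] (u n)
  z_nonneg : ∀ n ω, 0 ≤ z n ω
  u_nonneg : ∀ n ω, 0 ≤ u n ω
  u_le_one : ∀ n ω, u n ω ≤ 1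
  p_nonneg : ∀ n ω, 0 ≤ p n ω
  p_le_one : ∀ n ω, p n ω ≤ 1
  step : ∀ n ω, z (n + 1) ω = (1 - r n) * z n ω + r n * u n ω
  cond : ∀ n, μ[u n | ℱ n] =ᵐ[μ] p n
  rate_nonneg : ∀ n, 0 ≤ r n
  rate_le_one : ∀ n, r n ≤ 1
  rate : Tendsto (fun n : ℕ => (n : ℝ) * r n) atTop (𝓝 1)
  c_pos : 0 < c
  δ_pos : 0 < δ
  ε_pos : 0 < ε
  mul_le_p : ∀ n ω, c * z n ω ≤ p n ω
  repulsive : ∀ n ω, z n ω ≤ ε → (1 + δ) * z n ω ≤ p n ω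

namespace IsScalarScheme

variable {μ : Measure Ω} {ℱ : Filtration ℕ mΩ} {r : ℕ → ℝ}
  {z u p : ℕ → Ω → ℝ} {c δ ε : ℝ}

theorem abs_noise_le (H : IsScalarScheme μ ℱ r z u p c δ ε) (n : ℕ) (ω : Ω) :
    |u n ω - p n ω| ≤ 1 :=
  abs_le.2 ⟨by linarith [H.u_nonneg n ω, H.p_le_one n ω],
    by linarith [H.u_le_one n ω, H.p_nonneg n ω]⟩

theorem noise_meas (H : IsScalarScheme μ ℱ r z u p c δ ε) (n : ℕ) :
    StronglyMeasurable[ℱ (n + 1)] fun ω => u n ω - p n ω :=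
  (H.u_meas n).sub ((H.p_meas n).mono (ℱ.mono n.le_succ))

/-- Dropping the nonnegative inputs leaves pure decay; this turns the divergence of the products
into `∑ z n = ∞`. -/
theorem prod_mul_le (H : IsScalarScheme μ ℱ r z u p c δ ε) (n : ℕ) (ω : Ω) :
    (∏ k ∈ Finset.range n, (1 - r k)) * z 0 ω ≤ z n ω := by
  induction n with
  | zero => simp
  | succ n ih =>
    rw [Finset.prod_range_succ, H.step]
    have h1 := mul_le_mul_of_nonneg_left ih (sub_nonneg.2 (H.rate_le_one n))
    have h2 := mul_nonneg (H.rate_nonneg n) (H.u_nonneg n ω)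
    linarith

theorem eventually_rate_bounds (H : IsScalarScheme μ ℱ r z u p c δ ε) :
    ∀ᶠ n : ℕ in atTop, 1 ≤ n ∧ r n < 1 ∧ n * r n ≤ 2 := by
  filter_upwards [eventually_ge_atTop 1, H.rate.eventually_lt_const (show (1 : ℝ) < 2 by norm_num),
    (tendsto_zero_of_mul_tendsto H.rate).eventually_lt_const zero_lt_one] with n h1 h2 h3
  exact ⟨h1, h3, h2.le⟩

variable [IsProbabilityMeasure μ]

theorem integrable_u (H : IsScalarScheme μ ℱ r z u p c δ ε) (n : ℕ) : Integrable (u n) μ :=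
  integrable_of_abs_le ((H.u_meas n).mono (ℱ.le _)) (C := 1) fun ω =>
    abs_le.2 ⟨by linarith [H.u_nonneg n ω], H.u_le_one n ω⟩

theorem integrable_p (H : IsScalarScheme μ ℱ r z u p c δ ε) (n : ℕ) : Integrable (p n) μ :=
  integrable_of_abs_le ((H.p_meas n).mono (ℱ.le _)) (C := 1) fun ω =>
    abs_le.2 ⟨by linarith [H.p_nonneg n ω], H.p_le_one n ω⟩

theorem condExp_noise (H : IsScalarScheme μ ℱ r z u p c δ ε) (n : ℕ) :
    μ[fun ω => u n ω - p n ω | ℱ n] =ᵐ[μ] 0 := by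
  filter_upwards [condExp_sub (H.integrable_u n) (H.integrable_p n) (ℱ n), H.cond n] with ω h1 h2
  change (μ[u n - p n | ℱ n]) ω = 0
  rw [h1, Pi.sub_apply, h2,
    condExp_of_stronglyMeasurable (ℱ.le n) (H.p_meas n) (H.integrable_p n), sub_self]

/-- If the step sizes leave the initial state a non-summable weight, then on the event of
extinction `n z n` is unbounded. -/
theorem ae_frequently_ge (H : IsScalarScheme μ ℱ r z u p c δ ε)
    (hdiv : ¬ Summable fun n : ℕ => ∏ k ∈ Finset.range (n + 1), (1 - r k)) :
    ∀ᵐ ω ∂μ, z 0 ω ≠ 0 → Tendsto (fun n => z n ω) atTop (𝓝 0) →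
      ∀ K : ℝ, ∃ᶠ n : ℕ in atTop, K ≤ n * z n ω := by
  have hw : Tendsto (fun n : ℕ => ((n : ℝ) + 1) * r n) atTop (𝓝 1) := by
    have := H.rate.add (tendsto_zero_of_mul_tendsto H.rate)
    rw [add_zero] at this
    refine this.congr fun n => by ring
  obtain ⟨R, hR⟩ := hw.bddAbove_range
  -- These weights are those of the noise in the increment of `n z n`. They are bounded, so the
  -- martingale almost surely does not tend to `-∞`.
  have hM := martingale_weightedSum (μ := μ) H.noise_meas H.abs_noise_le H.condExp_noise
    fun n : ℕ => ((n : ℝ) + 1) * r n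
  have hbd := hM.ae_not_tendsto_atTop_atBot (R := R.toNNReal) (Eventually.of_forall fun ω n => by
    rw [Finset.sum_range_succ, add_sub_cancel_left, abs_mul]
    have hwn : 0 ≤ ((n : ℝ) + 1) * r n := mul_nonneg (by positivity) (H.rate_nonneg n)
    rw [abs_of_nonneg hwn]
    refine (mul_le_of_le_one_right hwn (H.abs_noise_le n ω)).trans ?_
    exact (hR ⟨n, rfl⟩).trans (Real.le_coe_toNNReal R))
  filter_upwards [hbd] with ω hω hz0 hlim K hcon
  refine hω ?_
  have hsum : Tendsto (fun n => ∑ k ∈ Finset.range n, z k ω) atTop atTop := by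
    refine (not_summable_iff_tendsto_nat_atTop_of_nonneg fun n => H.z_nonneg n ω).1 fun hs => ?_
    have hz : 0 < z 0 ω := lt_of_le_of_ne (H.z_nonneg 0 ω) (Ne.symm hz0)
    have hs1 := (summable_nat_add_iff 1).2 hs
    refine hdiv ?_
    refine Summable.of_nonneg_of_le (fun n => Finset.prod_nonneg fun k _ =>
      sub_nonneg.2 (H.rate_le_one k)) (fun n => ?_) (hs1.div_const (z 0 ω))
    rw [le_div_iff₀ hz]
    exact H.prod_mul_le (n + 1) ω
  obtain ⟨n0, hn0⟩ := eventually_atTop.1 ((hlim.eventually_lt_const H.ε_pos).and hcon)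
  set M : ℕ → ℝ := fun n => ∑ k ∈ Finset.range n, ((k : ℝ) + 1) * r k * (u k ω - p k ω) with hMdef
  -- The increment of `n z n` is `z n + (n + 1) r n (p n - z n)` plus that of `M`, and `p n ≥ z n`
  -- by repulsion; the bound telescopes.
  have key : ∀ n, n0 ≤ n → M n ≤ M n0 + n * z n ω - n0 * z n0 ω -
      (∑ k ∈ Finset.range n, z k ω - ∑ k ∈ Finset.range n0, z k ω) := by
    intro n hn
    induction n, hn using Nat.le_induction with
    | base => simp
    | succ n hn ih =>
      have hs : M (n + 1) = M n + ((n : ℝ) + 1) * r n * (u n ω - p n ω) := by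
        simp only [hMdef, Finset.sum_range_succ]
      rw [hs, Finset.sum_range_succ, H.step]
      have hp := H.repulsive n ω (hn0 n hn).1.le
      have h1 : 0 ≤ ((n : ℝ) + 1) * r n * (p n ω - z n ω) := by
        have := mul_nonneg H.δ_pos.le (H.z_nonneg n ω)
        exact mul_nonneg (mul_nonneg (by positivity) (H.rate_nonneg n)) (by linarith)
      push_cast
      linarith
  have hbot : Tendsto (fun n => (M n0 + K - n0 * z n0 ω + ∑ k ∈ Finset.range n0, z k ω)
      - ∑ k ∈ Finset.range n, z k ω) atTop atBot :=
    tendsto_atBot_add_const_left _ _ (tendsto_neg_atTop_atBot.comp hsum)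
  refine tendsto_atBot_mono' _ ?_ hbot
  filter_upwards [eventually_ge_atTop n0] with n hn
  have h1 := key n hn
  have h2 := not_le.1 (hn0 n hn).2
  linarith

/-- If `n z n` is unbounded, then it tends to infinity. -/
theorem ae_eventually_gt (H : IsScalarScheme μ ℱ r z u p c δ ε) {K : ℝ} (hK : 0 < K) :
    ∀ᵐ ω ∂μ, (∀ K' : ℝ, ∃ᶠ n : ℕ in atTop, K' ≤ n * z n ω) →
      ∀ᶠ n : ℕ in atTop, K < n * z n ω := by
  -- The inequality amounts to `n r n + r n - c / (1 + 2 / K) * (n r n) ≤ 1`, whose left side tends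
  -- to `1 - c / (1 + 2 / K) < 1`; any `c > 0` suffices.
  have hrate : ∀ᶠ n : ℕ in atTop,
      (n : ℝ) * (1 - c * r n / (1 + 2 / K)) ≤ ((n : ℝ) + 1) * (1 - r n) := by
    have h1 : Tendsto (fun n : ℕ => (n : ℝ) * r n + r n - c / (1 + 2 / K) * ((n : ℝ) * r n)) atTop
        (𝓝 (1 + 0 - c / (1 + 2 / K) * 1)) :=
      (H.rate.add (tendsto_zero_of_mul_tendsto H.rate)).sub (H.rate.const_mul _)
    have h2 : 0 < c / (1 + 2 / K) := div_pos H.c_pos (by positivity)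
    filter_upwards [h1.eventually_lt_const (show _ < (1 : ℝ) by linarith)] with n hn
    have e : c * r n / (1 + 2 / K) = c / (1 + 2 / K) * r n := by ring
    rw [e]
    linarith
  obtain ⟨n0, hn0⟩ := eventually_atTop.1 (H.eventually_rate_bounds.and hrate)
  -- This is `min 1 (K / (n z n))`, set to its largest value `1` until the rate bounds hold, so that
  -- it is a supermartingale from time `0`.
  set X : ℕ → Ω → ℝ := fun n ω => if n < n0 then 1 else K / max K (n * z n ω) with hX
  have hX0 : ∀ n ω, 0 ≤ X n ω := fun n ω => by
    simp only [hX]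
    split_ifs
    · exact zero_le_one
    · exact div_nonneg hK.le (hK.le.trans (le_max_left _ _))
  have hX1 : ∀ n ω, X n ω ≤ 1 := fun n ω => by
    simp only [hX]
    split_ifs
    · exact le_rfl
    · exact div_le_one_of_le₀ (le_max_left _ _) (hK.le.trans (le_max_left _ _))
  have hXm : ∀ n, StronglyMeasurable[ℱ n] (X n) := fun n => by
    by_cases hn : n < n0
    · simp only [hX, if_pos hn]; exact stronglyMeasurable_const
    · simp only [hX, if_neg hn]
      have hφ : Measurable fun x : ℝ => K / max K (n * x) := by fun_prop
      exact (hφ.comp (H.z_meas n).measurable).stronglyMeasurable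
  have hXi : ∀ n, Integrable (X n) μ := fun n =>
    integrable_of_abs_le ((hXm n).mono (ℱ.le n)) (C := 1) fun ω => by
      rw [abs_of_nonneg (hX0 n ω)]; exact hX1 n ω
  have hsuper : Supermartingale X ℱ μ := by
    refine supermartingale_nat hXm hXi fun n => ?_
    by_cases hn : n < n0
    · refine condExp_le_of_le_affine (ℱ.le n) (hXi (n + 1)) (a := fun _ => 1) (b := fun _ => 0)
        stronglyMeasurable_const stronglyMeasurable_const (A := 1) (B := 0) (by simp) (by simp)
        (H.integrable_u n) (H.cond n) (fun ω => by simpa using hX1 (n + 1) ω) fun ω => ?_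
      simp [hX, hn]
    have hnn : n0 ≤ n := not_lt.1 hn
    obtain ⟨⟨hn1, hr1, hr2⟩, hr3⟩ := hn0 n hnn
    have hr0 := H.rate_nonneg n
    have hnpos : (0 : ℝ) < n := by exact_mod_cast hn1
    have hr1' : 0 < 1 - r n := by linarith
    -- `φ - ψ u` is the affine majorant of `X (n + 1)`: the chord of `inv_step_le` when `n z n > K`,
    -- the trivial bound `1` otherwise.
    set φ : ℝ → ℝ := fun x => if n * x ≤ K then 1 else K / (n + 1) * (1 / ((1 - r n) * x)) with hφ
    set ψ : ℝ → ℝ := fun x => if n * x ≤ K then 0 else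
      K / (n + 1) * (1 / ((1 - r n) * x) * (r n / ((1 - r n) * x + r n))) with hψ
    have hφm : Measurable φ := Measurable.ite (measurableSet_le (by fun_prop) (by fun_prop))
      (by fun_prop) (by fun_prop)
    have hψm : Measurable ψ := Measurable.ite (measurableSet_le (by fun_prop) (by fun_prop))
      (by fun_prop) (by fun_prop)
    have hbase : ∀ x, K < n * x → 0 ≤ K / (n + 1) * (1 / ((1 - r n) * x)) ∧
        K / (n + 1) * (1 / ((1 - r n) * x)) ≤ 1 + 1 / (1 - r n) := fun x hx => by
      have hxp : 0 < x := pos_of_mul_pos_right (hK.trans hx) hnpos.le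
      refine ⟨by positivity, ?_⟩
      have : K / (n + 1) * (1 / ((1 - r n) * x)) = K / ((n + 1) * x) * (1 / (1 - r n)) := by
        field_simp
      rw [this]
      have h1 : K / ((n + 1) * x) ≤ 1 := by
        rw [div_le_one (by positivity)]; nlinarith
      have h2 : 0 ≤ 1 / (1 - r n) := by positivity
      have := mul_le_of_le_one_left h2 h1
      linarith
    refine condExp_le_of_le_affine (ℱ.le n) (hXi (n + 1)) (a := fun ω => φ (z n ω))
      (b := fun ω => ψ (z n ω)) (hφm.comp (H.z_meas n).measurable).stronglyMeasurable
      (hψm.comp (H.z_meas n).measurable).stronglyMeasurable (A := 1 + 1 / (1 - r n))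
      (B := 1 + 1 / (1 - r n)) (fun ω => ?_) (fun ω => ?_)
      (H.integrable_u n) (H.cond n) (fun ω => ?_) fun ω => ?_
    · by_cases h : n * z n ω ≤ K
      · simp only [hφ, if_pos h, abs_one]
        have : 0 ≤ 1 / (1 - r n) := by positivity
        linarith
      · simp only [hφ, if_neg h]
        obtain ⟨h1, h2⟩ := hbase _ (not_le.1 h)
        rw [abs_of_nonneg h1]; exact h2
    · by_cases h : n * z n ω ≤ K
      · simp only [hψ, if_pos h, abs_zero]
        positivity
      · simp only [hψ, if_neg h]
        obtain ⟨h1, h2⟩ := hbase _ (not_le.1 h)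
        have hxp : 0 < z n ω := pos_of_mul_pos_right (hK.trans (not_le.1 h)) hnpos.le
        have h3 : 0 ≤ r n / ((1 - r n) * z n ω + r n) := by positivity
        have h4 : r n / ((1 - r n) * z n ω + r n) ≤ 1 :=
          div_le_one_of_le₀ (by have := mul_pos hr1' hxp; linarith) (by positivity)
        rw [← mul_assoc, abs_of_nonneg (mul_nonneg h1 h3)]
        exact (mul_le_of_le_one_right h1 h4).trans h2
    · by_cases h : n * z n ω ≤ K
      · simp only [hφ, hψ, if_pos h]
        simpa using hX1 (n + 1) ω
      · simp only [hφ, hψ, if_neg h]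
        have hxp : 0 < z n ω := pos_of_mul_pos_right (hK.trans (not_le.1 h)) hnpos.le
        have h1 := inv_step_le hxp hr0 hr1 (H.u_nonneg n ω) (H.u_le_one n ω)
        have hz' : 0 < z (n + 1) ω := by
          rw [H.step]
          have := mul_nonneg hr0 (H.u_nonneg n ω)
          have := mul_pos hr1' hxp
          linarith
        have h2 : X (n + 1) ω ≤ K / (n + 1) * (1 / z (n + 1) ω) := by
          simp only [hX, if_neg (show ¬ n + 1 < n0 by omega)]
          rw [div_mul_div_comm, mul_one]
          have := le_max_right K ((↑(n + 1) : ℝ) * z (n + 1) ω)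
          push_cast at this ⊢
          gcongr
        rw [H.step] at h2
        have h3 := mul_le_mul_of_nonneg_left h1 (show 0 ≤ K / ((n : ℝ) + 1) by positivity)
        linarith
    · have hXn : X n ω = K / max K (n * z n ω) := by simp only [hX, if_neg hn]
      rw [hXn]
      by_cases h : n * z n ω ≤ K
      · simp only [hφ, hψ, if_pos h]
        rw [max_eq_left h, div_self hK.ne']
        simp
      · simp only [hφ, hψ, if_neg h]
        rw [max_eq_right (not_le.1 h).le]
        have hxp : 0 < z n ω := pos_of_mul_pos_right (hK.trans (not_le.1 h)) hnpos.le
        have hrx : K * r n ≤ 2 * z n ω := by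
          have h5 := mul_le_mul_of_nonneg_right (not_le.1 h).le hr0
          have h6 := mul_le_mul_of_nonneg_right hr2 hxp.le
          linarith
        have h4 := mul_weight_ge hxp hr0 hr1 H.c_pos.le hK hrx (H.mul_le_p n ω)
        set Q := r n / ((1 - r n) * z n ω + r n) * p n ω
        have h5 : K / (n + 1) * (1 / ((1 - r n) * z n ω)) -
            K / (n + 1) * (1 / ((1 - r n) * z n ω) * (r n / ((1 - r n) * z n ω + r n))) * p n ω =
            K / z n ω * ((1 - Q) / ((n + 1) * (1 - r n))) := by
          simp only [Q]
          field_simp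
        rw [h5]
        have h6 : K / (n * z n ω) = K / z n ω * (1 / n) := by field_simp
        rw [h6]
        refine mul_le_mul_of_nonneg_left ?_ (by positivity)
        rw [div_le_div_iff₀ (by positivity) hnpos]
        have h7 := mul_le_mul_of_nonneg_left (show 1 - Q ≤ 1 - c * r n / (1 + 2 / K) by linarith)
          hnpos.le
        linarith
  filter_upwards [ae_exists_tendsto_of_supermartingale hsuper hX0] with ω ⟨l, hl⟩ hfreq
  -- Visits of `n z n` above `4 K` bring `X` down to at most `1/4` infinitely often, so `l > 1/2` is
  -- impossible.
  have hl0 : l < 1 := by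
    by_contra hcon
    have h1 := hl.eventually_const_lt (show (1 / 2 : ℝ) < l by linarith)
    obtain ⟨n, hn, hn', hn''⟩ := ((hfreq (4 * K)).and_eventually
      (h1.and (eventually_ge_atTop n0))).exists
    simp only [hX, if_neg (not_lt.2 hn'')] at hn'
    rw [max_eq_right (by linarith), lt_div_iff₀ (by linarith)] at hn'
    linarith
  filter_upwards [hl.eventually_lt_const hl0, eventually_ge_atTop n0] with n hn hn'
  simp only [hX, if_neg (not_lt.2 hn')] at hn
  by_contra hcon
  rw [max_eq_left (not_lt.1 hcon), div_self hK.ne'] at hn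
  exact lt_irrefl _ hn

/-- If `n z n` is eventually large, then `z n` does not vanish in the limit. -/
theorem ae_not_tendsto_zero_of_eventually_gt (H : IsScalarScheme μ ℱ r z u p c δ ε) {K : ℝ}
    (hK : 0 < K) (hKδ : 2 / K ≤ δ) :
    ∀ᵐ ω ∂μ, (∀ᶠ n : ℕ in atTop, K < n * z n ω) → ¬ Tendsto (fun n => z n ω) atTop (𝓝 0) := by
  obtain ⟨N0, hN0⟩ := eventually_atTop.1 H.eventually_rate_bounds
  -- The event that the scheme has stayed, since `n0`, where both the repulsion and `mul_weight_ge`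
  -- apply. Killing `1 / z n` outside it keeps each `X n0 n` bounded.
  set S : ℕ → ℕ → Set Ω := fun n0 n =>
    ⋂ k ∈ Finset.Icc n0 n, {ω | K ≤ k * z k ω ∧ z k ω ≤ ε} with hS
  have hSm : ∀ n0 n, MeasurableSet[ℱ n] (S n0 n) := fun n0 n => by
    refine Finset.measurableSet_biInter _ fun k hk => ?_
    refine ℱ.mono (Finset.mem_Icc.1 hk).2 _ ?_
    have hs : MeasurableSet {x : ℝ | K ≤ k * x ∧ x ≤ ε} :=
      MeasurableSet.inter (s₁ := {x : ℝ | K ≤ k * x}) (s₂ := {x : ℝ | x ≤ ε})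
        (measurableSet_le (by fun_prop) (by fun_prop))
        (measurableSet_le (by fun_prop) (by fun_prop))
    exact (H.z_meas k).measurable hs
  have hSmem : ∀ {n0 n ω}, ω ∈ S n0 n ↔ ∀ k, n0 ≤ k → k ≤ n → K ≤ k * z k ω ∧ z k ω ≤ ε :=
    fun {n0 n ω} => by simp [hS]
  -- The value `n0 / K` before `n0` dominates `1 / z n0` on `S n0 n0`, so the switch at `n0`
  -- respects the supermartingale inequality.
  set X : ℕ → ℕ → Ω → ℝ := fun n0 n =>
    if n < n0 then fun _ => n0 / K else (S n0 n).indicator fun ω => 1 / z n ω with hX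
  have hXlt : ∀ {n0 n}, n < n0 → X n0 n = fun _ => (n0 : ℝ) / K := fun h => by simp [hX, h]
  have hXge : ∀ {n0 n}, n0 ≤ n → X n0 n = (S n0 n).indicator fun ω => 1 / z n ω :=
    fun h => by simp [hX, not_lt.2 h]
  have hzpos : ∀ {n0 n ω}, n0 ≤ n → ω ∈ S n0 n → 0 < z n ω := fun {n0 n ω} h hω => by
    have h1 := (hSmem.1 hω n h le_rfl).1
    exact pos_of_mul_pos_right (hK.trans_le h1) (Nat.cast_nonneg n)
  have hX0 : ∀ n0 n ω, 0 ≤ X n0 n ω := fun n0 n ω => by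
    rcases lt_or_ge n n0 with h | h
    · rw [hXlt h]; positivity
    · rw [hXge h]
      exact Set.indicator_nonneg (fun ω hω => (one_div_pos.2 (hzpos h hω)).le) ω
  have hXub : ∀ n0 n ω, X n0 n ω ≤ max (n0 / K) (n / K) := fun n0 n ω => by
    rcases lt_or_ge n n0 with h | h
    · rw [hXlt h]; exact le_max_left _ _
    · rw [hXge h]
      refine le_trans ?_ (le_max_right _ _)
      by_cases hω : ω ∈ S n0 n
      · rw [Set.indicator_of_mem hω, div_le_div_iff₀ (hzpos h hω) hK]
        linarith [(hSmem.1 hω n h le_rfl).1]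
      · rw [Set.indicator_of_notMem hω]; positivity
  have hXm : ∀ n0 n, StronglyMeasurable[ℱ n] (X n0 n) := fun n0 n => by
    rcases lt_or_ge n n0 with h | h
    · rw [hXlt h]; exact stronglyMeasurable_const
    · rw [hXge h]
      refine StronglyMeasurable.indicator ?_ (hSm n0 n)
      have hφ : Measurable fun x : ℝ => 1 / x := by fun_prop
      exact (hφ.comp (H.z_meas n).measurable).stronglyMeasurable
  have hXi : ∀ n0 n, Integrable (X n0 n) μ := fun n0 n =>
    integrable_of_abs_le ((hXm n0 n).mono (ℱ.le n)) fun ω => by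
      rw [abs_of_nonneg (hX0 n0 n ω)]; exact hXub n0 n ω
  have hsuper : ∀ n0, N0 ≤ n0 → Supermartingale (X n0) ℱ μ := by
    intro n0 hn0
    refine supermartingale_nat (hXm n0) (hXi n0) fun n => ?_
    rcases lt_or_ge n n0 with hn | hn
    · refine condExp_le_of_le_affine (ℱ.le n) (hXi n0 (n + 1)) (a := fun _ => n0 / K)
        (b := fun _ => 0) stronglyMeasurable_const stronglyMeasurable_const (A := |n0 / K|)
        (B := 0) (by simp) (by simp) (H.integrable_u n) (H.cond n) (fun ω => ?_) fun ω => ?_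
      · rw [zero_mul, sub_zero]
        refine (hXub n0 (n + 1) ω).trans (max_le le_rfl ?_)
        gcongr
        exact_mod_cast hn
      · rw [hXlt hn]; simp
    obtain ⟨hn1, hr1, hr2⟩ := hN0 n (hn0.trans hn)
    have hr0 := H.rate_nonneg n
    have hnpos : (0 : ℝ) < n := by exact_mod_cast hn1
    have hr1' : 0 < 1 - r n := by linarith
    set φ : ℝ → ℝ := fun x => 1 / ((1 - r n) * x) with hφ
    set ψ : ℝ → ℝ := fun x => 1 / ((1 - r n) * x) * (r n / ((1 - r n) * x + r n)) with hψ
    have hφm : Measurable φ := by fun_prop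
    have hψm : Measurable ψ := by fun_prop
    have hφb : ∀ ω ∈ S n0 n, 0 ≤ φ (z n ω) ∧ φ (z n ω) ≤ n / ((1 - r n) * K) := fun ω hω => by
      have hz := hzpos hn hω
      refine ⟨by simp only [hφ]; positivity, ?_⟩
      simp only [hφ]
      rw [div_le_div_iff₀ (by positivity) (by positivity)]
      have := mul_le_mul_of_nonneg_left (hSmem.1 hω n hn le_rfl).1 hr1'.le
      linarith
    refine condExp_le_of_le_affine (ℱ.le n) (hXi n0 (n + 1))
      (a := (S n0 n).indicator fun ω => φ (z n ω)) (b := (S n0 n).indicator fun ω => ψ (z n ω))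
      ((hφm.comp (H.z_meas n).measurable).stronglyMeasurable.indicator (hSm n0 n))
      ((hψm.comp (H.z_meas n).measurable).stronglyMeasurable.indicator (hSm n0 n))
      (A := n / ((1 - r n) * K)) (B := n / ((1 - r n) * K)) (fun ω => ?_) (fun ω => ?_)
      (H.integrable_u n) (H.cond n) (fun ω => ?_) fun ω => ?_
    · by_cases hω : ω ∈ S n0 n
      · rw [Set.indicator_of_mem hω, abs_of_nonneg (hφb ω hω).1]
        exact (hφb ω hω).2
      · rw [Set.indicator_of_notMem hω, abs_zero]; positivity
    · by_cases hω : ω ∈ S n0 n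
      · have hz := hzpos hn hω
        have h3 : 0 ≤ r n / ((1 - r n) * z n ω + r n) := by positivity
        have h4 : r n / ((1 - r n) * z n ω + r n) ≤ 1 :=
          div_le_one_of_le₀ (by have := mul_pos hr1' hz; linarith) (by positivity)
        obtain ⟨h1, h2⟩ := hφb ω hω
        rw [Set.indicator_of_mem hω]
        change |φ (z n ω) * _| ≤ _
        rw [abs_of_nonneg (mul_nonneg h1 h3)]
        exact (mul_le_of_le_one_right h1 h4).trans h2
      · rw [Set.indicator_of_notMem hω, abs_zero]; positivity
    · rw [hXge (hn.trans n.le_succ)]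
      by_cases hω : ω ∈ S n0 n
      · have hz := hzpos hn hω
        rw [Set.indicator_of_mem hω, Set.indicator_of_mem hω]
        refine le_trans ?_ (inv_step_le hz hr0 hr1 (H.u_nonneg n ω) (H.u_le_one n ω))
        rw [← H.step]
        refine Set.indicator_le_self' (fun _ _ => ?_) ω
        exact one_div_nonneg.2 (H.z_nonneg _ _)
      · have hω' : ω ∉ S n0 (n + 1) := fun h => hω (hSmem.2 fun k hk hk' =>
          hSmem.1 h k hk (hk'.trans n.le_succ))
        rw [Set.indicator_of_notMem hω, Set.indicator_of_notMem hω, Set.indicator_of_notMem hω']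
        simp
    · rw [hXge hn]
      by_cases hω : ω ∈ S n0 n
      · have hz := hzpos hn hω
        rw [Set.indicator_of_mem hω, Set.indicator_of_mem hω, Set.indicator_of_mem hω]
        obtain ⟨hKz, hzε⟩ := hSmem.1 hω n hn le_rfl
        have hrx : K * r n ≤ 2 * z n ω := by
          have h5 := mul_le_mul_of_nonneg_right hKz hr0
          have h6 := mul_le_mul_of_nonneg_right hr2 hz.le
          linarith
        have h4 := mul_weight_ge hz hr0 hr1 (by linarith [H.δ_pos]) hK hrx (H.repulsive n ω hzε)
        -- The gain `1 + δ` from repulsion outweighs the loss `1 + 2 / K`; hence `Q ≥ r n`, and `1 /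
        -- z n` does not grow in conditional mean.
        have h5 : r n ≤ (1 + δ) * r n / (1 + 2 / K) := by
          rw [le_div_iff₀ (by positivity)]
          have := mul_le_mul_of_nonneg_left hKδ hr0
          linarith
        set Q := r n / ((1 - r n) * z n ω + r n) * p n ω with hQ
        have h6 : φ (z n ω) - ψ (z n ω) * p n ω = 1 / z n ω * ((1 - Q) / (1 - r n)) := by
          simp only [Q, hφ, hψ]
          field_simp
        rw [h6]
        refine mul_le_of_le_one_right (by positivity) ?_
        rw [div_le_one hr1']
        linarith
      · rw [Set.indicator_of_notMem hω, Set.indicator_of_notMem hω, Set.indicator_of_notMem hω]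
        simp
  have hall : ∀ᵐ ω ∂μ, ∀ n0, N0 ≤ n0 → ∃ l, Tendsto (fun n => X n0 n ω) atTop (𝓝 l) := by
    rw [ae_all_iff]
    intro n0
    by_cases h : N0 ≤ n0
    · filter_upwards [ae_exists_tendsto_of_supermartingale (hsuper n0 h) (hX0 n0)] with ω hω _
        using hω
    · exact Eventually.of_forall fun ω h' => absurd h' h
  filter_upwards [hall] with ω hω hev hlim
  obtain ⟨n0, hn0⟩ := eventually_atTop.1
    ((hev.and (hlim.eventually_lt_const H.ε_pos)).and (eventually_ge_atTop N0))
  obtain ⟨l, hl⟩ := hω n0 (hn0 n0 le_rfl).2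
  have hmem : ∀ n, ω ∈ S n0 n := fun n => hSmem.2 fun k hk _ =>
    ⟨(hn0 k hk).1.1.le, (hn0 k hk).1.2.le⟩
  -- On this trajectory `X n0 n * z n = 1` for `n ≥ n0`, whereas a finite limit of `X` and `z n → 0`
  -- give the limit `0`.
  have hprod : Tendsto (fun n => X n0 n ω * z n ω) atTop (𝓝 (l * 0)) := hl.mul hlim
  have hone : Tendsto (fun n => X n0 n ω * z n ω) atTop (𝓝 1) := by
    refine tendsto_const_nhds.congr' ?_
    filter_upwards [eventually_ge_atTop n0] with n hn
    rw [hXge hn, Set.indicator_of_mem (hmem n), one_div,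
      inv_mul_cancel₀ (hzpos hn (hmem n)).ne']
  have := tendsto_nhds_unique hprod hone
  simp at this

/-- Non-extinction: a repulsive scheme started away from `0` does not converge to `0`. -/
theorem ae_not_tendsto_zero (H : IsScalarScheme μ ℱ r z u p c δ ε)
    (hdiv : ¬ Summable fun n : ℕ => ∏ k ∈ Finset.range (n + 1), (1 - r k)) :
    ∀ᵐ ω ∂μ, z 0 ω ≠ 0 → ¬ Tendsto (fun n => z n ω) atTop (𝓝 0) := by
  have hK : 0 < 2 / δ := div_pos two_pos H.δ_pos
  filter_upwards [H.ae_frequently_ge hdiv, H.ae_eventually_gt hK,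
    H.ae_not_tendsto_zero_of_eventually_gt hK (by rw [div_div_cancel₀ two_ne_zero])]
    with ω h1 h2 h3 hz hlim
  exact h3 (h2 (h1 hz hlim)) hlim

end IsScalarScheme

end

/-! ### The system, its filtration and its noise. -/

/-- The conditional probability of `I_{n+1,h} = 1` given the past. -/
def target {Ω : Type*} {N : ℕ} (α β q : ℝ) (f : ℝ → ℝ) (Z : ℕ → Ω → Fin N → ℝ) (n : ℕ)
    (h : Fin N) (ω : Ω) : ℝ :=
  α * ((∑ i, Z n ω i) / N) + β * q + (1 - α - β) * f (Z n ω h)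

/-- The martingale difference of component `h`. -/
def noise {Ω : Type*} {N : ℕ} (α β q : ℝ) (f : ℝ → ℝ) (Z I : ℕ → Ω → Fin N → ℝ) (n : ℕ)
    (h : Fin N) (ω : Ω) : ℝ :=
  I (n + 1) ω h - target α β q f Z n h ω

namespace IsSystem

variable {Ω : Type*} [mΩ : MeasurableSpace Ω] {P : Measure Ω} {N : ℕ} {α β q : ℝ}
  {f : ℝ → ℝ} {r : ℕ → ℝ} {Z I : ℕ → Ω → Fin N → ℝ}

theorem past_le (H : IsSystem P α β q f r Z I) (n : ℕ) : past Z I n ≤ mΩ := by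
  refine sup_le (iSup_le fun h => (H.measurable_init h).comap_le) ?_
  refine iSup₂_le fun k hk => iSup_le fun h => ?_
  obtain ⟨j, rfl⟩ := Nat.exists_eq_succ_of_ne_zero
    (Nat.one_le_iff_ne_zero.1 (Finset.mem_Icc.1 hk).1)
  exact (H.measurable_choice j h).comap_le

/-- The filtration of the past. -/
def filtration (H : IsSystem P α β q f r Z I) : Filtration ℕ mΩ where
  seq := past Z I
  mono' := fun m n hmn => by
    refine sup_le_sup_left (iSup₂_le fun k hk => ?_) _
    exact le_iSup₂_of_le k (Finset.Icc_subset_Icc_right hmn hk) le_rfl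
  le' := H.past_le

theorem measurable_choice_past (H : IsSystem P α β q f r Z I) (n : ℕ) (h : Fin N) :
    Measurable[H.filtration (n + 1)] fun ω => I (n + 1) ω h := by
  refine Measurable.of_comap_le (le_sup_of_le_right ?_)
  exact le_iSup₂_of_le (n + 1) (Finset.mem_Icc.2 ⟨by omega, le_rfl⟩)
    (le_iSup (fun h => MeasurableSpace.comap (fun ω => I (n + 1) ω h) inferInstance) h)

theorem measurable_state_past (H : IsSystem P α β q f r Z I) (n : ℕ) (h : Fin N) :
    Measurable[H.filtration n] fun ω => Z n ω h := by
  induction n with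
  | zero =>
    refine Measurable.of_comap_le (le_sup_of_le_left ?_)
    exact le_iSup (fun h => MeasurableSpace.comap (fun ω => Z 0 ω h) inferInstance) h
  | succ n ih =>
    have h1 : Measurable[H.filtration (n + 1)] fun ω => Z n ω h :=
      ih.mono (H.filtration.mono n.le_succ) le_rfl
    have h2 := H.measurable_choice_past n h
    simp_rw [H.dynamics n]
    exact (h1.const_mul _).add (h2.const_mul _)

theorem choice_nonneg (H : IsSystem P α β q f r Z I) (n : ℕ) (ω : Ω) (h : Fin N) :
    0 ≤ I (n + 1) ω h := by
  rcases H.choice_mem n ω h with h | h <;> rw [h]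
  exact zero_le_one

theorem choice_le_one (H : IsSystem P α β q f r Z I) (n : ℕ) (ω : Ω) (h : Fin N) :
    I (n + 1) ω h ≤ 1 := by
  rcases H.choice_mem n ω h with h | h <;> rw [h]
  exact zero_le_one

theorem state_mem (H : IsSystem P α β q f r Z I) (hr0 : ∀ n, 0 ≤ r n) (hr1 : ∀ n, r n ≤ 1)
    (n : ℕ) (ω : Ω) (h : Fin N) : 0 ≤ Z n ω h ∧ Z n ω h ≤ 1 := by
  induction n with
  | zero => exact H.init_mem ω h
  | succ n ih =>
    rw [H.dynamics]
    have h0 := H.choice_nonneg n ω h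
    have h1 := H.choice_le_one n ω h
    have h2 := sub_nonneg.2 (hr1 n)
    have h3 := mul_nonneg h2 ih.1
    have h4 := mul_nonneg (hr0 n) h0
    have h5 := mul_le_of_le_one_right h2 ih.2
    have h6 := mul_le_of_le_one_right (hr0 n) h1
    exact ⟨by linarith, by linarith⟩

theorem integrable_choice (H : IsSystem P α β q f r Z I) [IsProbabilityMeasure P] (n : ℕ)
    (h : Fin N) : Integrable (fun ω => I (n + 1) ω h) P :=
  integrable_of_abs_le (H.measurable_choice n h).stronglyMeasurable (C := 1) fun ω => by
    rw [abs_of_nonneg (H.choice_nonneg n ω h)]; exact H.choice_le_one n ω h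

theorem condExp_choice (H : IsSystem P α β q f r Z I) (n : ℕ) (h : Fin N) :
    P[fun ω => I (n + 1) ω h | H.filtration n] =ᵐ[P] target α β q f Z n h := by
  have : (fun ω => I (n + 1) ω h) =
      {ω | I (n + 1) ω h = 1}.indicator (fun _ => (1 : ℝ)) := by
    ext ω
    rcases H.choice_mem n ω h with h | h <;> simp [Set.indicator, h]
  rw [this]
  exact H.condProb n h

end IsSystem

/-! ### Almost sure limits for the linear-probability system. -/

section LP

variable {Ω : Type*} [mΩ : MeasurableSpace Ω] {P : Measure Ω} {N : ℕ} {α β q θ xs : ℝ}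
  {r : ℕ → ℝ} {Z I : ℕ → Ω → Fin N → ℝ}

theorem measurable_fLP : Measurable (fLP θ xs) := by
  unfold fLP; fun_prop

/-- The parameter restrictions, with the rates of the system. -/
structure Admissible (N : ℕ) (α β q θ xs : ℝ) (r : ℕ → ℝ) : Prop where
  card_pos : 0 < N
  alpha_nonneg : 0 ≤ α
  beta_nonneg : 0 ≤ β
  sum_pos : 0 < α + β
  sum_lt_one : α + β < 1
  q_pos : 0 < q
  q_le_one : q ≤ 1
  theta_pos : 0 < θ
  xs_pos : 0 < xs
  mul_le_one : θ * xs ≤ 1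
  le_mul : 1 - θ ≤ θ * xs
  rate_nonneg : ∀ n, 0 ≤ r n
  rate_le_one : ∀ n, r n ≤ 1
  rate : Tendsto (fun n : ℕ => (n : ℝ) * r n) atTop (𝓝 1)

theorem Admissible.alpha_lt_one (A : Admissible N α β q θ xs r) : α < 1 := by
  linarith [A.beta_nonneg, A.sum_lt_one]

namespace IsSystem

theorem target_mem (H : IsSystem P α β q (fLP θ xs) r Z I)
    (A : Admissible N α β q θ xs r)
    (n : ℕ) (h : Fin N) (ω : Ω) :
    0 ≤ target α β q (fLP θ xs) Z n h ω ∧ target α β q (fLP θ xs) Z n h ω ≤ 1 := by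
  have hZ := H.state_mem A.rate_nonneg A.rate_le_one n ω
  have ha := mul_nonneg A.alpha_nonneg (le_average A.card_pos fun h => (hZ h).1)
  have hb := mul_le_of_le_one_right A.alpha_nonneg (average_le A.card_pos fun h => (hZ h).2)
  have hγ : 0 ≤ 1 - α - β := by linarith [A.sum_lt_one]
  have hc := mul_nonneg hγ (fLP_nonneg A.theta_pos A.xs_pos (hZ h).1)
  have hd := mul_le_of_le_one_right hγ
    (fLP_le_one A.theta_pos A.xs_pos A.le_mul (hZ h).1 (hZ h).2)
  have he := mul_nonneg A.beta_nonneg A.q_pos.le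
  have hf := mul_le_of_le_one_right A.beta_nonneg A.q_le_one
  unfold target
  exact ⟨by linarith, by linarith⟩

theorem target_meas (H : IsSystem P α β q (fLP θ xs) r Z I)
    (n : ℕ) (h : Fin N) :
    StronglyMeasurable[H.filtration n] (target α β q (fLP θ xs) Z n h) := by
  have h1 := H.measurable_state_past n
  have h2 : Measurable[H.filtration n] fun ω => ∑ i, Z n ω i :=
    Finset.measurable_fun_sum _ fun i _ => h1 i
  have h3 : Measurable[H.filtration n] fun ω => fLP θ xs (Z n ω h) := measurable_fLP.comp (h1 h)
  exact ((((h2.div_const _).const_mul _).add_const _).add (h3.const_mul _)).stronglyMeasurable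

theorem noise_meas (H : IsSystem P α β q (fLP θ xs) r Z I)
    (n : ℕ) (h : Fin N) :
    StronglyMeasurable[H.filtration (n + 1)] (noise α β q (fLP θ xs) Z I n h) :=
  (H.measurable_choice_past n h).stronglyMeasurable.sub
    ((H.target_meas n h).mono (H.filtration.mono n.le_succ))

theorem abs_noise_le (H : IsSystem P α β q (fLP θ xs) r Z I)
    (A : Admissible N α β q θ xs r)
    (n : ℕ) (h : Fin N) (ω : Ω) :
    |noise α β q (fLP θ xs) Z I n h ω| ≤ 1 := by
  have h1 := H.target_mem A n h ω
  have h2 := H.choice_nonneg n ω h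
  have h3 := H.choice_le_one n ω h
  exact abs_le.2 ⟨by unfold noise; linarith, by unfold noise; linarith⟩

theorem integrable_target (H : IsSystem P α β q (fLP θ xs) r Z I)
    (A : Admissible N α β q θ xs r)
    [IsProbabilityMeasure P] (n : ℕ) (h : Fin N) :
    Integrable (target α β q (fLP θ xs) Z n h) P :=
  integrable_of_abs_le ((H.target_meas n h).mono (H.filtration.le n)) (C := 1) fun ω => by
    have := H.target_mem A n h ω
    rw [abs_of_nonneg this.1]; exact this.2

theorem condExp_noise (H : IsSystem P α β q (fLP θ xs) r Z I)
    (A : Admissible N α β q θ xs r)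
    [IsProbabilityMeasure P] (n : ℕ) (h : Fin N) :
    P[noise α β q (fLP θ xs) Z I n h | H.filtration n] =ᵐ[P] 0 := by
  filter_upwards [condExp_sub (H.integrable_choice n h) (H.integrable_target A n h)
    (H.filtration n), H.condExp_choice n h] with ω h1 h2
  change (P[(fun ω => I (n + 1) ω h) - target α β q (fLP θ xs) Z n h | H.filtration n]) ω = 0
  rw [h1, Pi.sub_apply, h2, condExp_of_stronglyMeasurable (H.filtration.le n) (H.target_meas n h)
    (H.integrable_target A n h), sub_self]

theorem ae_exists_tendsto_noise (H : IsSystem P α β q (fLP θ xs) r Z I)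
    (A : Admissible N α β q θ xs r)
    [IsProbabilityMeasure P] {w : ℕ → ℝ}
    (hw : Summable fun n => w n ^ 2) : ∀ᵐ ω ∂P, ∀ h, ∃ s, Tendsto
      (fun n => ∑ k ∈ Finset.range n, w k * noise α β q (fLP θ xs) Z I k h ω) atTop (𝓝 s) :=
  ae_all_iff.2 fun h => ae_exists_tendsto_weightedSum (fun n => H.noise_meas n h)
    (fun n => H.abs_noise_le A n h) (fun n => H.condExp_noise A n h) hw

/-- Almost every trajectory of the system is driven by a convergent noise series. -/
theorem ae_isPath (H : IsSystem P α β q (fLP θ xs) r Z I)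
    (A : Admissible N α β q θ xs r)
    [IsProbabilityMeasure P] :
    ∀ᵐ ω ∂P, IsPath α (β * q) (1 - α - β) (fLP θ xs) r (fun n => Z n ω)
      fun n h => r n * noise α β q (fLP θ xs) Z I n h ω := by
  filter_upwards [H.ae_exists_tendsto_noise A (summable_sq_of_mul_tendsto A.rate_nonneg A.rate)]
    with ω hω
  exact
    { card_pos := A.card_pos
      nonneg := fun n h => (H.state_mem A.rate_nonneg A.rate_le_one n ω h).1
      le_one := fun n h => (H.state_mem A.rate_nonneg A.rate_le_one n ω h).2
      step := fun n h => by rw [H.dynamics]; unfold noise target; ring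
      noise := hω
      rate_nonneg := A.rate_nonneg
      rate_tendsto := tendsto_zero_of_mul_tendsto A.rate
      rate_div := not_summable_of_mul_tendsto A.rate
      alpha_nonneg := A.alpha_nonneg
      kappa_nonneg := mul_nonneg A.beta_nonneg A.q_pos.le
      gamma_nonneg := by linarith [A.sum_lt_one]
      sum_le_one := by
        have := mul_le_of_le_one_right A.beta_nonneg A.q_le_one
        linarith
      f_nonneg := fun x hx => fLP_nonneg A.theta_pos A.xs_pos hx
      f_le_one := fun x hx hx1 => fLP_le_one A.theta_pos A.xs_pos A.le_mul hx hx1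
      f_mul_ge := fun t x ht0 ht1 hx => fLP_mul_ge A.theta_pos A.xs_pos ht0 ht1 hx
      f_cont := fun x hx => continuousAt_fLP A.theta_pos A.xs_pos hx }

theorem _root_.ReinforcedSystem.Admissible.average_target_ge
    (A : Admissible N α β q θ xs r)
    {k : ℝ} {n : ℕ} {ω : Ω}
    (hk : ∀ h, k * Z n ω h ≤ fLP θ xs (Z n ω h)) :
    (α + (1 - α - β) * k) * ((∑ i, Z n ω i) / N) ≤
      (∑ h, target α β q (fLP θ xs) Z n h ω) / N := by
  have hN : (0 : ℝ) < N := by exact_mod_cast A.card_pos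
  have hγ : 0 ≤ 1 - α - β := by linarith [A.sum_lt_one]
  have hκ := mul_nonneg A.beta_nonneg A.q_pos.le
  have h1 : ∑ h, (α * ((∑ i, Z n ω i) / N) + (1 - α - β) * (k * Z n ω h)) ≤
      ∑ h, target α β q (fLP θ xs) Z n h ω := by
    refine Finset.sum_le_sum fun h _ => ?_
    have := mul_le_mul_of_nonneg_left (hk h) hγ
    unfold target
    linarith
  rw [Finset.sum_add_distrib, ← Finset.mul_sum, ← Finset.mul_sum] at h1
  simp only [Finset.sum_const, Finset.card_univ, Fintype.card_fin, nsmul_eq_mul] at h1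
  rw [le_div_iff₀ hN]
  refine le_trans (le_of_eq ?_) h1
  field_simp
  rw [← Finset.mul_sum]
  ring

/-- Without forcing and with `f' 0 > 1`, the average target exceeds the average inclination near
`0` by a fixed factor. -/
theorem exists_repulsive (H : IsSystem P α β q (fLP θ xs) r Z I)
    (A : Admissible N α β q θ xs r)
    (hβ : β = 0) (hlt : θ * xs < 1) : ∃ δ > 0, ∃ ε > 0, ∀ n ω,
    (∑ i, Z n ω i) / N ≤ ε → (1 + δ) * ((∑ i, Z n ω i) / N) ≤
      (∑ h, target α β q (fLP θ xs) Z n h ω) / N := by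
  have hθ := A.theta_pos
  have hN : (0 : ℝ) < N := by exact_mod_cast A.card_pos
  -- This choice gives `θ (ε + x*) = (1 + θ x*) / 2 < 1`, so the slope `k` exceeds `1`.
  set ε := (1 - θ * xs) / (2 * θ) with hε
  have hε0 : 0 < ε := div_pos (by linarith) (by linarith)
  set k := 1 / (θ * (ε + xs)) with hk
  have hk1 : 1 < k := by
    have hxs := A.xs_pos
    rw [hk, lt_div_iff₀ (by positivity), one_mul]
    have : θ * ε = (1 - θ * xs) / 2 := by rw [hε]; field_simp
    linarith
  have hγ : 0 < 1 - α - β := by linarith [A.sum_lt_one]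
  -- For `β = 0`, `α + (1 - α - β) k = 1 + δ`. An average below `ε / N` forces every component below
  -- `ε`.
  refine ⟨(1 - α - β) * (k - 1), mul_pos hγ (by linarith), ε / N, by positivity,
    fun n ω hle => ?_⟩
  have hZ := H.state_mem A.rate_nonneg A.rate_le_one n ω
  have h1 := A.average_target_ge (n := n) (ω := ω) (k := k) fun h => by
    refine fLP_ge_of_le hθ A.xs_pos (hZ h).1 ?_
    refine (le_mul_average A.card_pos (fun h => (hZ h).1) h).trans ?_
    rw [le_div_iff₀ hN] at hle
    linarith
  refine le_trans (le_of_eq ?_) h1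
  rw [hβ]; ring

/-- The average is a scalar scheme driven by the average choice. The constant `c` comes from `f x ≥
x / (θ (1 + x*))` on `[0, 1]`, and `δ`, `ε` from `exists_repulsive`. -/
theorem ae_average_not_tendsto_zero (H : IsSystem P α β q (fLP θ xs) r Z I)
    (A : Admissible N α β q θ xs r)
    [IsProbabilityMeasure P] (hβ : β = 0) (hlt : θ * xs < 1)
    (hdiv : ¬ Summable fun n : ℕ => ∏ k ∈ Finset.range (n + 1), (1 - r k)) :
    ∀ᵐ ω ∂P, Z 0 ω ≠ 0 → ¬ Tendsto (fun n => (∑ i, Z n ω i) / N) atTop (𝓝 0) := by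
  obtain ⟨δ, hδ, ε, hε, hrep⟩ := H.exists_repulsive A hβ hlt
  have hZ := H.state_mem A.rate_nonneg A.rate_le_one
  have hθ := A.theta_pos
  have hxs := A.xs_pos
  have hγ : 0 < 1 - α - β := by linarith [A.sum_lt_one]
  have hk : 0 < 1 / (θ * (1 + xs)) := by positivity
  have S : IsScalarScheme P H.filtration r (fun n ω => (∑ i, Z n ω i) / N)
      (fun n ω => (∑ i, I (n + 1) ω i) / N)
      (fun n ω => (∑ h, target α β q (fLP θ xs) Z n h ω) / N)
      (α + (1 - α - β) * (1 / (θ * (1 + xs)))) δ ε :=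
    { z_meas := fun n => ((Finset.measurable_fun_sum _ fun i _ =>
        H.measurable_state_past n i).div_const _).stronglyMeasurable
      p_meas := fun n => ((Finset.measurable_fun_sum _ fun i _ =>
        (H.target_meas n i).measurable).div_const _).stronglyMeasurable
      u_meas := fun n => ((Finset.measurable_fun_sum _ fun i _ =>
        H.measurable_choice_past n i).div_const _).stronglyMeasurable
      z_nonneg := fun n ω => le_average A.card_pos fun h => (hZ n ω h).1
      u_nonneg := fun n ω => le_average A.card_pos (H.choice_nonneg n ω)
      u_le_one := fun n ω => average_le A.card_pos (H.choice_le_one n ω)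
      p_nonneg := fun n ω => le_average A.card_pos fun h => (H.target_mem A n h ω).1
      p_le_one := fun n ω => average_le A.card_pos fun h => (H.target_mem A n h ω).2
      step := fun n ω => by
        simp_rw [H.dynamics n, Finset.sum_add_distrib, ← Finset.mul_sum]
        ring
      cond := fun n => by
        have e : (fun ω => (∑ i, I (n + 1) ω i) / (N : ℝ)) =
            (N : ℝ)⁻¹ • ∑ i, fun ω => I (n + 1) ω i := by
          ext ω
          simp [div_eq_inv_mul]
        rw [e]
        filter_upwards [condExp_smul (μ := P) (N : ℝ)⁻¹ (∑ i, fun ω => I (n + 1) ω i)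
          (H.filtration n), condExp_finsetSum (s := Finset.univ) (fun i _ =>
          H.integrable_choice n i) (H.filtration n),
          ae_all_iff.2 fun i => H.condExp_choice n i] with ω h1 h2 h3
        rw [h1, Pi.smul_apply, h2, Finset.sum_apply, smul_eq_mul, div_eq_inv_mul]
        congr 1
        exact Finset.sum_congr rfl fun i _ => h3 i
      rate_nonneg := A.rate_nonneg
      rate_le_one := A.rate_le_one
      rate := A.rate
      c_pos := add_pos_of_nonneg_of_pos A.alpha_nonneg (mul_pos hγ hk)
      δ_pos := hδ
      ε_pos := hε
      mul_le_p := fun n ω => A.average_target_ge fun h =>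
        fLP_ge_of_le hθ hxs (hZ n ω h).1 (hZ n ω h).2
      repulsive := hrep }
  filter_upwards [S.ae_not_tendsto_zero hdiv] with ω hω h0
  refine hω fun hcon => h0 ?_
  ext h
  have := le_mul_average A.card_pos (fun h => (hZ 0 ω h).1) h
  rw [hcon, mul_zero] at this
  exact le_antisymm this (hZ 0 ω h).1

/-- The nonzero start is a condition on `ω`, so all martingale arguments take place under `P` and
conditioning is postponed to `ae_pHat`. -/
theorem ae_tendsto_state (H : IsSystem P α β q (fLP θ xs) r Z I)
    (A : Admissible N α β q θ xs r)
    [IsProbabilityMeasure P]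
    (hdiv : β = 0 → θ * xs < 1 →
      ¬ Summable fun n : ℕ => ∏ k ∈ Finset.range (n + 1), (1 - r k)) :
    ∀ᵐ ω ∂P, (β = 0 → θ * xs < 1 → Z 0 ω ≠ 0) →
      Tendsto (fun n => Z n ω) atTop (𝓝 fun _ => zInf α β q θ xs) := by
  have hα1 := A.alpha_lt_one
  have hne : ∀ᵐ ω ∂P, β = 0 → θ * xs < 1 → Z 0 ω ≠ 0 →
      ¬ Tendsto (fun n => (∑ i, Z n ω i) / N) atTop (𝓝 0) := by
    by_cases h : β = 0 ∧ θ * xs < 1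
    · filter_upwards [H.ae_average_not_tendsto_zero A h.1 h.2 (hdiv h.1 h.2)] with ω hω _ _
        using hω
    · exact Eventually.of_forall fun ω h1 h2 => absurd ⟨h1, h2⟩ h
  filter_upwards [H.ae_isPath A, hne] with ω hp hω hz0
  have hz := zInf_nonneg (β := β) hα1 A.q_pos A.theta_pos A.xs_pos A.mul_le_one
  have hup := hp.eventually_le hz fun x hx => netDrift_neg_of_gt hα1 A.beta_nonneg A.q_pos
    A.theta_pos A.xs_pos (hz.trans_lt hx) hx
  have hlow : ∀ c < zInf α β q θ xs, ∀ᶠ n in atTop, ∀ h, c ≤ Z n ω h := by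
    rcases A.beta_nonneg.eq_or_lt with hβ | hβ
    · rcases A.mul_le_one.eq_or_lt with h1 | h1
      · intro c hc
        have : zInf α β q θ xs = 0 := by
          rw [zInf, if_neg (by rw [← hβ]; exact lt_irrefl _), h1, sub_self, zero_div]
        rw [this] at hc
        exact Eventually.of_forall fun n h => hc.le.trans (hp.nonneg n h)
      · have hα : 0 < α := by linarith [A.sum_pos]
        obtain ⟨δ, hδ, ε, hε, hrep⟩ := H.exists_repulsive A hβ.symm h1
        obtain hcon | ⟨c, hc, hev⟩ := hp.average_tendsto_zero_or_eventually_ge hε fun n hn => by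
          refine le_trans ?_ (hrep n ω hn)
          have := mul_nonneg hδ.le (le_average hp.card_pos (hp.nonneg n))
          linarith
        · exact absurd hcon (hω hβ.symm h1 (hz0 hβ.symm h1))
        obtain ⟨c', hc', hev'⟩ := hp.eventually_ge_of_average_ge hα hc hev
        refine hp.eventually_ge hc'.le ?_ hev' fun x hx hx' =>
          netDrift_pos_of_lt hα1 A.beta_nonneg A.q_pos A.theta_pos A.xs_pos (hc'.le.trans hx)
            (Or.inr (hc'.trans_le hx)) hx'
        exact add_pos_of_pos_of_nonneg (mul_pos hα hc') hp.kappa_nonneg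
    · refine hp.eventually_ge le_rfl ?_ (Eventually.of_forall hp.nonneg) fun x hx hx' =>
        netDrift_pos_of_lt hα1 A.beta_nonneg A.q_pos A.theta_pos A.xs_pos hx (Or.inl hβ) hx'
      rw [mul_zero, zero_add]
      exact mul_pos hβ A.q_pos
  refine tendsto_pi_nhds.2 fun h => tendsto_order.2 ⟨fun a ha => ?_, fun a ha => ?_⟩
  · obtain ⟨b, hab, hb⟩ := exists_between ha
    exact (hlow b hb).mono fun n hn => hab.trans_le (hn h)
  · obtain ⟨b, hb, hab⟩ := exists_between ha
    exact (hup b hb).mono fun n hn => (hn h).trans_lt hab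

theorem empMean_mem (H : IsSystem P α β q (fLP θ xs) r Z I)
    (n : ℕ) (ω : Ω) (h : Fin N) :
    0 ≤ empMean I n ω h ∧ empMean I n ω h ≤ 1 := by
  have hI : ∀ k ∈ Finset.Icc 1 n, 0 ≤ I k ω h ∧ I k ω h ≤ 1 := fun k hk => by
    obtain ⟨j, rfl⟩ := Nat.exists_eq_succ_of_ne_zero
      (Nat.one_le_iff_ne_zero.1 (Finset.mem_Icc.1 hk).1)
    exact ⟨H.choice_nonneg j ω h, H.choice_le_one j ω h⟩
  unfold empMean
  refine ⟨div_nonneg (Finset.sum_nonneg fun k hk => (hI k hk).1) (Nat.cast_nonneg n),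
    div_le_one_of_le₀ ?_ (Nat.cast_nonneg n)⟩
  simpa using Finset.sum_le_card_nsmul _ _ 1 fun k hk => (hI k hk).2

theorem ae_tendsto_empMean (H : IsSystem P α β q (fLP θ xs) r Z I)
    (A : Admissible N α β q θ xs r)
    [IsProbabilityMeasure P] :
    ∀ᵐ ω ∂P, Tendsto (fun n => Z n ω) atTop (𝓝 fun _ => zInf α β q θ xs) →
      Tendsto (fun n => empMean I n ω) atTop (𝓝 fun _ => zInf α β q θ xs) := by
  have hw0 : ∀ n : ℕ, 0 ≤ 1 / ((n : ℝ) + 1) := fun n => by positivity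
  have hw : Tendsto (fun n : ℕ => (n : ℝ) * (1 / ((n : ℝ) + 1))) atTop (𝓝 1) := by
    simpa [div_eq_mul_inv] using tendsto_natCast_div_add_atTop (1 : ℝ)
  filter_upwards [H.ae_exists_tendsto_noise A (summable_sq_of_mul_tendsto hw0 hw)]
    with ω hω hZ
  have hZh := tendsto_pi_nhds.1 hZ
  have hz := zInf_nonneg (β := β) A.alpha_lt_one A.q_pos A.theta_pos A.xs_pos A.mul_le_one
  refine tendsto_pi_nhds.2 fun h => ?_
  obtain ⟨s, hs⟩ := hω h
  have hN : (N : ℝ) ≠ 0 := by exact_mod_cast A.card_pos.ne'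
  have htar : Tendsto (fun n => target α β q (fLP θ xs) Z n h ω) atTop
      (𝓝 (zInf α β q θ xs)) := by
    have h1 : Tendsto (fun n => (∑ i, Z n ω i) / (N : ℝ)) atTop (𝓝 (zInf α β q θ xs)) := by
      have := (tendsto_finsetSum Finset.univ fun i _ => hZh i).div_const (N : ℝ)
      simpa [mul_div_cancel_left₀ _ hN] using this
    have h2 := (continuousAt_fLP A.theta_pos A.xs_pos hz).tendsto.comp (hZh h)
    have h3 := ((h1.const_mul α).add_const (β * q)).add (h2.const_mul (1 - α - β))
    -- Vanishing net drift says that `z_∞` is a fixed point of the synchronized target.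
    have h4 := netDrift_zInf A.alpha_lt_one A.beta_nonneg A.q_pos A.theta_pos A.xs_pos
      A.mul_le_one
    unfold netDrift at h4
    rwa [sub_eq_zero.1 h4] at h3
  refine tendsto_of_tracking (x := fun n => empMean I n ω h) (B := 1) (fun n => ?_) hw0
    (tendsto_zero_of_mul_tendsto hw) (not_summable_of_mul_tendsto hw) hs (fun n => ?_) htar
  · simp only [empMean, noise]
    rw [Finset.sum_Icc_succ_top (by omega)]
    push_cast
    -- At `n = 0` the empty mean is `0 / 0 = 0`, and the step size `1` makes the recursion return `I
    -- 1`.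
    rcases Nat.eq_zero_or_pos n with rfl | hn
    · simp
    · have : (n : ℝ) ≠ 0 := by positivity
      field_simp
      ring
  · have h1 := H.target_mem A n h ω
    have h2 := H.empMean_mem n ω h
    exact abs_le.2 ⟨by linarith, by linarith⟩

/-- The conditioned measure is a multiple of the restriction of `P` to `Z 0 ≠ 0`, so an implication
valid `P`-almost surely loses its premise there. -/
theorem ae_pHat (H : IsSystem P α β q (fLP θ xs) r Z I)
    {p : Ω → Prop} (hp : ∀ᵐ ω ∂P, (β = 0 → θ * xs < 1 → Z 0 ω ≠ 0) → p ω) :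
    ∀ᵐ ω ∂(pHat P β θ xs Z), p ω := by
  unfold pHat
  split_ifs with h
  · have hm : Measurable (Z 0) := measurable_pi_iff.2 H.measurable_init
    have hs : MeasurableSet {ω | Z 0 ω ≠ 0} := (hm (measurableSet_singleton 0)).compl
    unfold ProbabilityTheory.cond
    refine Measure.ae_smul_measure ((ae_restrict_iff' hs).2 ?_) _
    exact hp.mono fun ω h1 h2 => h1 fun _ _ => h2
  · exact hp.mono fun ω h1 => h1 fun h2 h3 => absurd ⟨h2, h3⟩ h

end IsSystem

end LP

end ReinforcedSystem

end

theorem theorem3p1 {Ω : Type*} [MeasurableSpace Ω] (P : Measure Ω) [IsProbabilityMeasure P]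
    (N : ℕ) (hN : 2 ≤ N) (α β q θ xs : ℝ)
    (hα0 : 0 ≤ α) (hα1 : α < 1) (hβ0 : 0 ≤ β) (hβ1 : β < 1)
    (hαβ0 : 0 < α + β) (hαβ1 : α + β < 1) (hq0 : 0 < q) (hq1 : q ≤ 1)
    (hθ : 0 < θ) (hθxs0 : 0 < θ * xs) (hθxs1 : θ * xs ≤ 1) (hθxs : 1 - θ ≤ θ * xs)
    (r : ℕ → ℝ) (hr0 : ∀ n, 0 ≤ r n) (hr1 : ∀ n, r n ≤ 1)
    (hr : Tendsto (fun n : ℕ => (n : ℝ) * r n) atTop (𝓝 1))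
    (hrdiv : β = 0 → θ * xs < 1 →
      ¬ Summable fun n : ℕ => ∏ k ∈ Finset.range (n + 1), (1 - r k))
    (Z I : ℕ → Ω → Fin N → ℝ)
    (hsys : ReinforcedSystem.IsSystem P α β q (ReinforcedSystem.fLP θ xs) r Z I) :
    (0 < β →
      0 < ReinforcedSystem.zHat α β q θ xs ∧ ReinforcedSystem.zHat α β q θ xs ≤ 1 ∧
      (ReinforcedSystem.zHat α β q θ xs = 1 ↔ q = 1 ∧ θ * xs = 1 - θ)) ∧
    ReinforcedSystem.Synchronizes (ReinforcedSystem.pHat P β θ xs Z) Z ∧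
    ReinforcedSystem.Predictable (ReinforcedSystem.pHat P β θ xs Z) Z ∧
    (∀ᵐ ω ∂(ReinforcedSystem.pHat P β θ xs Z),
      Tendsto (fun n => Z n ω) atTop (𝓝 fun _ => ReinforcedSystem.zInf α β q θ xs)) ∧
    (∀ᵐ ω ∂(ReinforcedSystem.pHat P β θ xs Z),
      Tendsto (fun n => ReinforcedSystem.empMean I n ω) atTop
        (𝓝 fun _ => ReinforcedSystem.zInf α β q θ xs)) := by

  have hxs : 0 < xs := pos_of_mul_pos_right hθxs0 hθ.le
  have A : ReinforcedSystem.Admissible N α β q θ xs r :=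
    ⟨by omega, hα0, hβ0, hαβ0, hαβ1, hq0, hq1, hθ, hxs, hθxs1, hθxs, hr0, hr1, hr⟩
  have hZ := hsys.ae_tendsto_state A hrdiv
  have hconv := hsys.ae_pHat hZ
  refine ⟨fun hβ => ReinforcedSystem.zHat_properties hα1 hβ hαβ1 hq0 hq1 hθ hxs hθxs,
    ⟨fun _ => ReinforcedSystem.zInf α β q θ xs, measurable_const, fun _ =>
      ⟨ReinforcedSystem.zInf_nonneg hα1 hq0 hθ hxs hθxs1,
        ReinforcedSystem.zInf_le_one hα1 hαβ1 hq0 hq1 hθ hxs hθxs⟩, hconv⟩,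
    ⟨_, hconv⟩, hconv, hsys.ae_pHat ?_⟩
  filter_upwards [hZ, hsys.ae_tendsto_empMean A] with ω h1 h2 h3
  exact h2 (h1 h3)
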